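/- All graphs are finite and simple. For a graph $G$ let $Q(G)=D(G)+A(G)$ be its signless Laplacian matrix (degree matrix plus adjacency matrix), and let $q_{\min}(G)$ be the least eigenvalue of $Q(G)$. The domination number $\gamma(G)$ is the minimum cardinality of a set $S\subseteq V(G)$ such that every vertex outside $S$ is adjacent to a vertex of $S$. For $g\ge 3$ odd and $k\ge 1$ with $g+k\le n$, let $U_n^k(g)$ be the graph of order $n$ obtained from a cycle $C_g$ and a star with center $c$ and $k$ leaves by joining a vertex of the cycle and $c$ by a path on $l=n+1-g-k$ vertices (both ends included; if $l=1$, the cycle vertex and $c$ are identified). If some graph $U_n^k(g)$ has domination number $\gamma$, let $V_n^\gamma(g)$ be the one among these graphs with domination number $\gamma$ for which $k$ is minimum. Let $G$ be a connected non-bipartite graph of order $n\ge 4$ with domination number $\gamma\le\frac{n+1}{3}$. Then $V_n^\gamma(3)$ is well defined, i.e. $\gamma(U_n^k(3))=\gamma$ for some $k$ with $1\le k\le n-3$, and $$q_{\min}(G)\ge q_{\min}(V_n^\gamma(3)),$$ with equality if and only if $G$ is isomorphic to $V_n^\gamma(3)$. -/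

import Mathlib

namespace SimpleGraph

/-- A set `S` of vertices is dominating if every vertex outside `S` is adjacent to at least one
vertex of `S`. -/
def IsDominatingSet {V : Type*} (G : SimpleGraph V) (S : Finset V) : Prop :=
  ∀ v, v ∉ S → ∃ u ∈ S, G.Adj v u

/-- The domination number: the minimum of the cardinalities of all dominating sets (the whole
vertex set is one, so that the infimum is taken over a nonempty set of natural numbers). -/
noncomputable def dominationNumber {V : Type*} [Fintype V] (G : SimpleGraph V) : ℕ :=
  sInf {m | ∃ S : Finset V, G.IsDominatingSet S ∧ S.card = m}

/-- The signless Laplacian matrix `Q(G) = D(G) + A(G)`. -/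
def signlessLapMatrix {V : Type*} [Fintype V] [DecidableEq V] (G : SimpleGraph V)
    [DecidableRel G.Adj] : Matrix V V ℝ :=
  G.degMatrix ℝ + G.adjMatrix ℝ

open Classical in
/-- The least eigenvalue of the signless Laplacian matrix. The matrix is real symmetric, so for
a nonempty vertex set its set of real eigenvalues is finite and nonempty and the infimum is
attained. -/
noncomputable def qMin {V : Type*} [Fintype V] (G : SimpleGraph V) : ℝ :=
  sInf {μ : ℝ | Module.End.HasEigenvalue (Matrix.toLin' G.signlessLapMatrix) μ}

/-- The graph `U_n^k(g)`, meaningful for `3 ≤ g`, `1 ≤ k` and `g + k ≤ n`, on the vertices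
`0, …, n - 1`.
* `0, 1, …, g - 1` form the cycle `C_g`;
* `g - 1, g, …, n - k - 1` is the path `P_l` with `l = n + 1 - g - k` vertices, from the cycle
  vertex `g - 1` to the center `n - k - 1` of the star (the two coincide if `l = 1`);
* `n - k, …, n - 1` are the `k` pendant vertices, all adjacent to the center `n - k - 1`.

Here `fromRel` symmetrizes the relation. Its first clause gives the consecutive edges of the cycle
and all edges of the path, the second one the closing edge of the cycle, the third one the star. -/
def uGraph (n k g : ℕ) : SimpleGraph (Fin n) :=
  SimpleGraph.fromRel fun i j =>
    ((i : ℕ) + 1 = j ∧ (j : ℕ) + k + 1 ≤ n) ∨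
    ((i : ℕ) = 0 ∧ (j : ℕ) + 1 = g) ∨
    ((i : ℕ) + k + 1 = n ∧ n ≤ (j : ℕ) + k)

/-- The numbers `k` for which `U_n^k(g)` is defined and has domination number `γ`. -/
def uGraphIndices (n γ g : ℕ) : Set ℕ :=
  {k | 1 ≤ k ∧ g + k ≤ n ∧ (uGraph n k g).dominationNumber = γ}

/-- The graph `V_n^γ(g)`: the graph `U_n^k(g)` with domination number `γ` whose `k` is minimum
(meaningful if there is such a `k`). -/
noncomputable def vGraph (n γ g : ℕ) : SimpleGraph (Fin n) :=
  uGraph n (sInf (uGraphIndices n γ g)) g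

end SimpleGraph

namespace SimpleGraph

/-- The contribution `(x i + x j) ^ 2` of the pair `s(i, j)` to the signless Laplacian form. -/
noncomputable def edgeEnergy {V : Type*} (x : V → ℝ) : Sym2 V → ℝ :=
  Sym2.lift ⟨fun i j => (x i + x j) ^ 2, fun i j => by simp only [add_comm]⟩

@[simp] theorem edgeEnergy_mk {V : Type*} (x : V → ℝ) (i j : V) :
    edgeEnergy x s(i, j) = (x i + x j) ^ 2 := rfl

theorem edgeEnergy_nonneg {V : Type*} (x : V → ℝ) (e : Sym2 V) : 0 ≤ edgeEnergy x e := by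
  induction e with | _ i j => exact sq_nonneg _

open Classical in
/-- The quadratic form of the signless Laplacian matrix. -/
noncomputable def energy {V : Type*} [Fintype V] (G : SimpleGraph V) (x : V → ℝ) : ℝ :=
  ∑ e : Sym2 V with e ∈ G.edgeSet, edgeEnergy x e

theorem signlessLapMatrix_eq_incMatrix_mul_transpose {V : Type*} [Fintype V] [DecidableEq V]
    (G : SimpleGraph V) [DecidableRel G.Adj] :
    G.signlessLapMatrix = G.incMatrix ℝ * (G.incMatrix ℝ).transpose := by
  rw [incMatrix_mul_transpose]
  ext a b
  by_cases h : a = b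
  · subst h
    simp [signlessLapMatrix, degMatrix]
  · simp [signlessLapMatrix, degMatrix, h, Matrix.diagonal_apply_ne]

theorem dotProduct_signlessLapMatrix_mulVec {V : Type*} [Fintype V] [DecidableEq V]
    (G : SimpleGraph V) [DecidableRel G.Adj] (x : V → ℝ) :
    dotProduct x (G.signlessLapMatrix.mulVec x) = G.energy x := by
  classical
  rw [signlessLapMatrix_eq_incMatrix_mul_transpose, ← Matrix.mulVec_mulVec,
    Matrix.dotProduct_mulVec, ← Matrix.mulVec_transpose, energy, Finset.sum_filter, dotProduct]
  refine Finset.sum_congr rfl fun e _ => ?_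
  rw [← sq]
  induction e with | _ i j =>
  split_ifs with he
  · have hne : i ≠ j := G.ne_of_adj he
    rw [edgeEnergy_mk]
    congr 1
    have : ∀ a, (G.incMatrix ℝ).transpose s(i, j) a * x a =
        (if a = i then x a else 0) + (if a = j then x a else 0) := by
      intro a
      rw [Matrix.transpose_apply]
      by_cases ha : a = i
      · subst ha
        rw [incMatrix_of_mem_incidenceSet _ ⟨he, by simp⟩]; simp [hne]
      · by_cases hb : a = j
        · subst hb
          rw [incMatrix_of_mem_incidenceSet _ ⟨he, by simp⟩]; simp [ha]
        · rw [incMatrix_of_notMem_incidenceSet]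
          · simp [ha, hb]
          · rintro ⟨-, h⟩
            simp [ha, hb] at h
    simp only [Matrix.mulVec, dotProduct, this, Finset.sum_add_distrib]
    simp
  · have : ∀ a, (G.incMatrix ℝ).transpose s(i, j) a * x a = 0 := by
      intro a
      rw [Matrix.transpose_apply, incMatrix_of_notMem_incidenceSet, zero_mul]
      rintro ⟨h, -⟩
      exact he h
    simp only [Matrix.mulVec, dotProduct, this]
    simp

theorem isHermitian_signlessLapMatrix {V : Type*} [Fintype V] [DecidableEq V]
    (G : SimpleGraph V) [DecidableRel G.Adj] : G.signlessLapMatrix.IsHermitian := by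
  rw [signlessLapMatrix_eq_incMatrix_mul_transpose]
  simpa using Matrix.isHermitian_mul_conjTranspose_self (G.incMatrix ℝ)

/-- The least eigenvalue is the minimum of the Rayleigh quotient. -/
theorem qMin_spec {V : Type*} [Fintype V] [Nonempty V] (G : SimpleGraph V) :
    (∃ x : V → ℝ, x ≠ 0 ∧ G.energy x = G.qMin * ∑ i, x i ^ 2) ∧
      ∀ y : V → ℝ, G.qMin * ∑ i, y i ^ 2 ≤ G.energy y := by
  classical
  have hA := G.isHermitian_signlessLapMatrix
  obtain ⟨i₀, -, hi₀⟩ := Finset.exists_min_image Finset.univ hA.eigenvalues Finset.univ_nonempty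
  set A := G.signlessLapMatrix with hAdef
  have hev : ∀ (μ : ℝ) (v : V → ℝ), v ≠ 0 → A.mulVec v = μ • v →
      Module.End.HasEigenvalue (Matrix.toLin' A) μ := by
    intro μ v hv h
    refine Module.End.hasEigenvalue_of_hasEigenvector (x := v) ⟨?_, hv⟩
    rw [Module.End.mem_eigenspace_iff, Matrix.toLin'_apply, h]
  have hbasis : ∀ i, (hA.eigenvectorBasis i).ofLp ≠ 0 := fun i h =>
    hA.eigenvectorBasis.orthonormal.ne_zero i (by ext k; simpa using congrFun h k)
  have hspec : ∀ μ, Module.End.HasEigenvalue (Matrix.toLin' A) μ → hA.eigenvalues i₀ ≤ μ := by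
    intro μ hμ
    have h1 : μ ∈ spectrum ℝ A := by
      rw [← Matrix.spectrum_toLin']
      exact hμ.mem_spectrum
    rw [hA.spectrum_real_eq_range_eigenvalues] at h1
    obtain ⟨j, rfl⟩ := h1
    exact hi₀ j (Finset.mem_univ j)
  have hq : G.qMin = hA.eigenvalues i₀ := by
    have : IsLeast {μ : ℝ | Module.End.HasEigenvalue (Matrix.toLin' A) μ} (hA.eigenvalues i₀) :=
      ⟨hev _ _ (hbasis i₀) (hA.mulVec_eigenvectorBasis i₀), fun μ hμ => hspec μ hμ⟩
    rw [← this.csInf_eq, qMin]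
  have hdot : ∀ y : V → ℝ, dotProduct y y = ∑ i, y i ^ 2 := fun y => by
    simp [dotProduct, sq]
  refine ⟨⟨_, hbasis i₀, ?_⟩, fun y => ?_⟩
  · rw [← dotProduct_signlessLapMatrix_mulVec, ← hAdef, hA.mulVec_eigenvectorBasis i₀,
      dotProduct_smul, hdot, hq, smul_eq_mul]
  · have hB : (A - G.qMin • (1 : Matrix V V ℝ)).IsHermitian :=
      hA.sub (by simp [Matrix.IsHermitian])
    have hpsd : (A - G.qMin • (1 : Matrix V V ℝ)).PosSemidef := by
      rw [hB.posSemidef_iff_eigenvalues_nonneg]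
      intro j
      have h1 := hB.mulVec_eigenvectorBasis j
      have h2 : (hB.eigenvectorBasis j).ofLp ≠ 0 := fun h =>
        hB.eigenvectorBasis.orthonormal.ne_zero j (by ext k; simpa using congrFun h k)
      rw [Matrix.sub_mulVec, Matrix.smul_mulVec, Matrix.one_mulVec, sub_eq_iff_eq_add,
        ← add_smul] at h1
      have := hspec _ (hev _ _ h2 h1)
      rw [← hq] at this
      simpa using this
    have := (Matrix.posSemidef_iff_dotProduct_mulVec.1 hpsd).2 y
    rw [Matrix.sub_mulVec, Matrix.smul_mulVec, Matrix.one_mulVec, star_trivial, dotProduct_sub,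
      dotProduct_smul, hdot, hAdef, dotProduct_signlessLapMatrix_mulVec, smul_eq_mul] at this
    linarith

theorem energy_comp_iso {V W : Type*} [Fintype V] [Fintype W] {G : SimpleGraph V}
    {H : SimpleGraph W} (φ : G ≃g H) (x : W → ℝ) : G.energy (x ∘ φ) = H.energy x := by
  classical
  unfold energy
  rw [Finset.sum_filter, Finset.sum_filter]
  refine Fintype.sum_bijective (Sym2.map φ) ⟨Sym2.map.injective φ.injective, fun e => ?_⟩ _ _
    fun e => ?_
  · exact ⟨Sym2.map φ.symm e, by simp [Sym2.map_map]⟩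
  · induction e with | _ i j =>
    simp only [Sym2.map_mk, mem_edgeSet, edgeEnergy_mk, Function.comp, φ.map_adj_iff]

theorem qMin_le_of_iso {V W : Type*} [Fintype V] [Fintype W] [Nonempty V] {G : SimpleGraph V}
    {H : SimpleGraph W} (φ : G ≃g H) : G.qMin ≤ H.qMin := by
  have : Nonempty W := φ.toEquiv.symm.nonempty
  obtain ⟨x, hx, hE⟩ := H.qMin_spec.1
  have h1 := G.qMin_spec.2 (x ∘ φ)
  have h2 : ∑ i, (x ∘ φ) i ^ 2 = ∑ i, x i ^ 2 :=
    Fintype.sum_equiv φ.toEquiv _ _ fun i => rfl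
  rw [energy_comp_iso, hE, h2] at h1
  refine le_of_mul_le_mul_right h1 ?_
  obtain ⟨i, hi⟩ := Function.ne_iff.1 hx
  exact Finset.sum_pos' (fun i _ => sq_nonneg _) ⟨i, Finset.mem_univ i, by
    have : x i ≠ 0 := hi
    positivity⟩

theorem qMin_eq_of_iso {V W : Type*} [Fintype V] [Fintype W] [Nonempty V] {G : SimpleGraph V}
    {H : SimpleGraph W} (φ : G ≃g H) : G.qMin = H.qMin :=
  have : Nonempty W := φ.toEquiv.symm.nonempty
  le_antisymm (qMin_le_of_iso φ) (qMin_le_of_iso φ.symm)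

theorem isBipartite_of_bool_coloring {V : Type*} {G : SimpleGraph V} (κ : V → Bool)
    (h : ∀ i j, G.Adj i j → κ i ≠ κ j) : G.IsBipartite := by
  have := (Coloring.mk κ fun {i j} hij => h i j hij).colorable
  simpa using this

theorem exists_bool_coloring_of_isBipartite {V : Type*} {G : SimpleGraph V} (h : G.IsBipartite) :
    ∃ κ : V → Bool, ∀ i j, G.Adj i j → κ i ≠ κ j := by
  obtain ⟨c⟩ := h
  refine ⟨fun v => decide (c v = 0), fun i j hij => ?_⟩
  have := c.valid hij
  intro h
  simp only [decide_eq_decide] at h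
  apply this
  revert h
  generalize c i = a
  generalize c j = b
  revert a b
  decide

/-- On a connected non-bipartite graph the least eigenvalue is positive. -/
theorem qMin_pos {V : Type*} [Fintype V] {G : SimpleGraph V} (hconn : G.Connected)
    (hbip : ¬ G.IsBipartite) : 0 < G.qMin := by
  classical
  have := hconn.nonempty
  obtain ⟨x, hx, hE⟩ := G.qMin_spec.1
  have hpos : 0 < ∑ i, x i ^ 2 := by
    obtain ⟨i, hi⟩ := Function.ne_iff.1 hx
    exact Finset.sum_pos' (fun i _ => sq_nonneg _) ⟨i, Finset.mem_univ i, by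
      have : x i ≠ 0 := hi
      positivity⟩
  by_contra hq
  have h0 : G.energy x ≤ 0 := by
    rw [hE]; exact mul_nonpos_of_nonpos_of_nonneg (not_lt.1 hq) hpos.le
  have h1 : G.energy x = 0 :=
    le_antisymm h0 (Finset.sum_nonneg fun e _ => edgeEnergy_nonneg x e)
  have h2 : ∀ i j, G.Adj i j → x i + x j = 0 := by
    intro i j hij
    have := (Finset.sum_eq_zero_iff_of_nonneg (fun e _ => edgeEnergy_nonneg x e)).1 h1 s(i, j)
      (by simpa using hij)
    simpa using this
  have h3 : ∀ i j, G.Reachable i j → |x i| = |x j| := by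
    rintro i j ⟨p⟩
    induction p with
    | nil => rfl
    | cons h p ih =>
      rw [← ih, show x _ = - x _ from eq_neg_of_add_eq_zero_left (h2 _ _ h), abs_neg]
  obtain ⟨i, hi⟩ := Function.ne_iff.1 hx
  have h4 : ∀ j, x j ≠ 0 := by
    intro j hj
    have := h3 i j (hconn i j)
    rw [hj, abs_zero, abs_eq_zero] at this
    exact hi this
  apply hbip
  refine isBipartite_of_bool_coloring (fun v => decide (0 < x v)) fun i j hij h => ?_
  simp only [decide_eq_decide] at h
  have := h2 i j hij
  rcases lt_or_gt_of_ne (h4 i) with h5 | h5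
  · have : 0 < x j := by linarith
    linarith [h.2 this]
  · linarith [h.1 h5]

theorem uGraph_adj_iff {n k : ℕ} {i j : Fin n} :
    (uGraph n k 3).Adj i j ↔ (i : ℕ) ≠ j ∧
      ((((i : ℕ) + 1 = j ∧ (j : ℕ) + k + 1 ≤ n) ∨ ((i : ℕ) = 0 ∧ (j : ℕ) = 2) ∨
        ((i : ℕ) + k + 1 = n ∧ n ≤ (j : ℕ) + k)) ∨
      (((j : ℕ) + 1 = i ∧ (i : ℕ) + k + 1 ≤ n) ∨ ((j : ℕ) = 0 ∧ (i : ℕ) = 2) ∨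
        ((j : ℕ) + k + 1 = n ∧ n ≤ (i : ℕ) + k))) := by
  simp only [uGraph, fromRel_adj, ne_eq, Fin.ext_iff]
  omega

theorem uGraph_one_eq_uGraph_zero (n : ℕ) : uGraph n 1 3 = uGraph n 0 3 := by
  ext i j
  rw [uGraph_adj_iff, uGraph_adj_iff]
  have := i.2
  have := j.2
  omega

theorem dominationNumber_uGraph_le {n k : ℕ} (hk : 3 + k ≤ n) :
    (uGraph n k 3).dominationNumber ≤ (n - k + 2) / 3 := by
  classical
  set m := (n - k + 2) / 3 with hm
  set f : ℕ → Fin n := fun i => ⟨max 2 (n - k - 1 - 3 * i), by omega⟩ with hf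
  have hD : (uGraph n k 3).IsDominatingSet ((Finset.range m).image f) := by
    intro v hv
    have hv' : ∀ i < m, (v : ℕ) ≠ max 2 (n - k - 1 - 3 * i) := by
      intro i hi h
      exact hv (Finset.mem_image.2 ⟨i, Finset.mem_range.2 hi, Fin.ext h.symm⟩)
    have hvn := v.2
    obtain ⟨i, hi, hadj⟩ : ∃ i < m, (uGraph n k 3).Adj v (f i) := by
      rcases Nat.lt_or_ge v 3 with h3 | h3
      · have := hv' (m - 1) (by omega)
        refine ⟨m - 1, by omega, ?_⟩
        rw [uGraph_adj_iff]
        simp only [hf]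
        omega
      · rcases Nat.lt_or_ge v (n - k) with h4 | h4
        · have := hv' ((n - k - v) / 3) (by omega)
          refine ⟨(n - k - v) / 3, by omega, ?_⟩
          rw [uGraph_adj_iff]
          simp only [hf]
          omega
        · refine ⟨0, by omega, ?_⟩
          rw [uGraph_adj_iff]
          simp only [hf]
          omega
    exact ⟨f i, Finset.mem_image.2 ⟨i, Finset.mem_range.2 hi, rfl⟩, hadj⟩
  refine le_trans (Nat.sInf_le ⟨(Finset.range m).image f, hD, rfl⟩) ?_
  exact Finset.card_image_le.trans_eq (Finset.card_range m)

theorem le_dominationNumber_uGraph {n k : ℕ} (hk1 : 1 ≤ k) (hk : 3 + k ≤ n) :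
    (n - k + 2) / 3 ≤ (uGraph n k 3).dominationNumber := by
  classical
  refine le_csInf ⟨_, Finset.univ, fun v hv => absurd (Finset.mem_univ v) hv, rfl⟩ ?_
  rintro _ ⟨S, hS, rfl⟩
  have key : ∀ i : Fin ((n - k + 2) / 3), ∃ u ∈ S,
      ((n - k - 3 * i ≤ (u : ℕ) + 1 ∧ (u : ℕ) ≤ n - k - 3 * i + 1) ∨
        (n - k - 3 * i = 2 ∧ (u : ℕ) = 0)) := by
    intro i
    have hi := i.2
    by_cases hx : (⟨n - k - 3 * i, by omega⟩ : Fin n) ∈ S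
    · exact ⟨_, hx, by simp only; omega⟩
    · obtain ⟨u, hu, hadj⟩ := hS _ hx
      rw [uGraph_adj_iff] at hadj
      simp only at hadj
      exact ⟨u, hu, by omega⟩
  choose f hfS hf using key
  have hinj : Function.Injective f := by
    intro i j hij
    have h1 := hf i
    have h2 := hf j
    rw [hij] at h1
    apply Fin.ext
    have := i.2
    have := j.2
    omega
  calc (n - k + 2) / 3 = (Finset.univ.image f).card := by
        rw [Finset.card_image_of_injective _ hinj]; simp
    _ ≤ S.card := Finset.card_le_card fun v hv => by
        obtain ⟨i, -, rfl⟩ := Finset.mem_image.1 hv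
        exact hfS i

theorem dominationNumber_uGraph {n k : ℕ} (hk1 : 1 ≤ k) (hk : 3 + k ≤ n) :
    (uGraph n k 3).dominationNumber = (n - k + 2) / 3 :=
  le_antisymm (dominationNumber_uGraph_le hk) (le_dominationNumber_uGraph hk1 hk)

theorem isLeast_uGraphIndices {n γ : ℕ} (hn : 4 ≤ n) (hγ : 1 ≤ γ) (hγn : 3 * γ ≤ n + 1) :
    IsLeast (uGraphIndices n γ 3) (max 1 (n - 3 * γ)) := by
  constructor
  · refine ⟨by omega, by omega, ?_⟩
    rw [dominationNumber_uGraph (by omega) (by omega)]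
    omega
  · rintro k ⟨h1, h2, h3⟩
    rw [dominationNumber_uGraph h1 h2] at h3
    omega

theorem vGraph_three_eq {n γ : ℕ} (hn : 4 ≤ n) (hγ : 1 ≤ γ) (hγn : 3 * γ ≤ n + 1) :
    vGraph n γ 3 = uGraph n (n - min n (3 * γ)) 3 := by
  rw [vGraph, (isLeast_uGraphIndices hn hγ hγn).csInf_eq]
  rcases Nat.lt_or_ge (3 * γ) n with h | h
  · rw [max_eq_right (by omega), min_eq_right h.le]
  · rw [max_eq_left (by omega), min_eq_left h, Nat.sub_self, uGraph_one_eq_uGraph_zero]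

/-- The `n` edges of `uGraph n (n - N) 3` are the pairs of a vertex and its partner; the partner
of `0` is `2`, the partner of a later vertex is its neighbor towards the triangle (`0` for `1`). -/
def uPartner {n N : ℕ} (hN : 3 ≤ N) (hNn : N ≤ n) (j : Fin n) : Fin n :=
  ⟨if (j : ℕ) = 0 then 2 else if (j : ℕ) < N then (j : ℕ) - 1 else N - 1, by split_ifs <;> omega⟩

theorem uPartner_val {n N : ℕ} (hN : 3 ≤ N) (hNn : N ≤ n) (j : Fin n) :
    (uPartner hN hNn j : ℕ) =
      if (j : ℕ) = 0 then 2 else if (j : ℕ) < N then (j : ℕ) - 1 else N - 1 := rfl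

theorem exists_uPartner_of_mem_edgeSet {n N : ℕ} (hN : 3 ≤ N) (hNn : N ≤ n) {e : Sym2 (Fin n)}
    (he : e ∈ (uGraph n (n - N) 3).edgeSet) : ∃ j, s(j, uPartner hN hNn j) = e := by
  induction e with | _ i j =>
  rw [mem_edgeSet, uGraph_adj_iff] at he
  have hi := i.2
  have hj := j.2
  have : j = uPartner hN hNn i ∨ i = uPartner hN hNn j := by
    rw [Fin.ext_iff, Fin.ext_iff, uPartner_val, uPartner_val]
    split_ifs <;> omega
  rcases this with h | h
  · exact ⟨i, by rw [← h]⟩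
  · exact ⟨j, by rw [← h, Sym2.eq_swap]⟩

theorem uGraph_adj_uPartner {n N : ℕ} (hN : 3 ≤ N) (hNn : N ≤ n) (j : Fin n) :
    (uGraph n (n - N) 3).Adj j (uPartner hN hNn j) := by
  rw [uGraph_adj_iff, uPartner_val]
  have := j.2
  split_ifs <;> omega

theorem card_edgeSet_uGraph_le {n N : ℕ} (hN : 3 ≤ N) (hNn : N ≤ n) :
    Nat.card (uGraph n (n - N) 3).edgeSet ≤ n := by
  classical
  have : Function.Surjective (fun j : Fin n =>
      (⟨s(j, uPartner hN hNn j), uGraph_adj_uPartner hN hNn j⟩ :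
        (uGraph n (n - N) 3).edgeSet)) := by
    rintro ⟨e, he⟩
    obtain ⟨j, hj⟩ := exists_uPartner_of_mem_edgeSet hN hNn he
    exact ⟨j, Subtype.ext hj⟩
  simpa using Nat.card_le_card_of_surjective _ this

/-- The linear form whose square is the energy of the edge `s(j, uPartner j)`, after the signs of
the two bipartition classes of the graph without the edge `s(0, 1)` have been changed. -/
def uLin {n N : ℕ} (hN : 3 ≤ N) (hNn : N ≤ n) (j : Fin n) (a : Fin n → ℝ) : ℝ :=
  if (j : ℕ) = 1 then a j + a (uPartner hN hNn j) else a j - a (uPartner hN hNn j)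

/-- The sum of the squares of the forms `uLin`. -/
def uForm {n N : ℕ} (hN : 3 ≤ N) (hNn : N ≤ n) (a : Fin n → ℝ) : ℝ :=
  ∑ j, uLin hN hNn j a ^ 2

/-- The signs of an eigenvector for the least eigenvalue of `uGraph n (n - N) 3`. -/
def uSign {n : ℕ} (N : ℕ) (j : Fin n) : ℝ :=
  if (j : ℕ) = 0 then 1 else (-1) ^ (min (j : ℕ) N + 1)

theorem uSign_sq {n : ℕ} (N : ℕ) (j : Fin n) : uSign N j ^ 2 = 1 := by
  unfold uSign
  split_ifs
  · norm_num
  · rw [← pow_mul, mul_comm, pow_mul]; norm_num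

theorem edgeEnergy_uSign_mul {n N : ℕ} (hN : 3 ≤ N) (hNn : N ≤ n) (j : Fin n) (a : Fin n → ℝ) :
    edgeEnergy (fun i => uSign N i * a i) s(j, uPartner hN hNn j) = uLin hN hNn j a ^ 2 := by
  rw [edgeEnergy_mk]
  have hj := j.2
  have hs : uSign N (uPartner hN hNn j) = (if (j : ℕ) = 1 then 1 else -1) * uSign N j := by
    unfold uSign
    rw [uPartner_val]
    rcases Nat.lt_or_ge j 3 with h | h
    · interval_cases h' : (j : ℕ)
      · norm_num [show min 2 N = 2 by omega]
      · norm_num [show min 1 N = 1 by omega, show 1 < N by omega]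
      · norm_num [show min 2 N = 2 by omega, show 2 < N by omega, show min 1 N = 1 by omega]
    · rw [if_neg (show ¬ (j : ℕ) = 0 by omega), if_neg (show ¬ (j : ℕ) = 0 by omega),
        if_neg (show ¬ (j : ℕ) = 1 by omega)]
      split_ifs with h1 h2 h2
      · omega
      · rw [show min ((j : ℕ) - 1) N + 1 = j by omega, show min (j : ℕ) N + 1 = j + 1 by omega,
          pow_succ]
        ring
      · omega
      · rw [show min (N - 1) N + 1 = N by omega, show min (j : ℕ) N + 1 = N + 1 by omega,
          pow_succ]
        ring
  have hsq := uSign_sq N j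
  rw [hs, uLin]
  split_ifs
  · linear_combination (a j + a (uPartner hN hNn j)) ^ 2 * hsq
  · linear_combination (a j - a (uPartner hN hNn j)) ^ 2 * hsq

theorem energy_uGraph_le {n N : ℕ} (hN : 3 ≤ N) (hNn : N ≤ n) (a : Fin n → ℝ) :
    (uGraph n (n - N) 3).energy (fun i => uSign N i * a i) ≤ uForm hN hNn a := by
  classical
  unfold energy uForm
  simp only [← edgeEnergy_uSign_mul]
  rw [← Finset.sum_fiberwise_of_maps_to (s := Finset.univ) (t := Finset.univ)
    (g := fun j => s(j, uPartner hN hNn j)) (fun _ _ => Finset.mem_univ _), Finset.sum_filter]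
  refine Finset.sum_le_sum fun e _ => ?_
  split_ifs with he
  · obtain ⟨j, rfl⟩ := exists_uPartner_of_mem_edgeSet hN hNn he
    exact Finset.single_le_sum
      (f := fun i => edgeEnergy (fun i => uSign N i * a i) s(i, uPartner hN hNn i))
      (fun i _ => edgeEnergy_nonneg _ _) (by simp)
  · exact Finset.sum_nonneg fun i _ => edgeEnergy_nonneg _ _

theorem qMin_uGraph_le {n N : ℕ} (hN : 3 ≤ N) (hNn : N ≤ n) (a : Fin n → ℝ) :
    (uGraph n (n - N) 3).qMin * ∑ i, a i ^ 2 ≤ uForm hN hNn a := by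
  have : Nonempty (Fin n) := ⟨⟨0, by omega⟩⟩
  refine le_trans (le_of_eq ?_) (((uGraph n (n - N) 3).qMin_spec.2 _).trans
    (energy_uGraph_le hN hNn a))
  congr 1
  refine Finset.sum_congr rfl fun i _ => ?_
  rw [mul_pow, uSign_sq, one_mul]

theorem uLin_add_mul {n N : ℕ} (hN : 3 ≤ N) (hNn : N ≤ n) (j : Fin n) (a h : Fin n → ℝ) (t : ℝ) :
    uLin hN hNn j (fun i => a i + t * h i) = uLin hN hNn j a + t * uLin hN hNn j h := by
  unfold uLin
  split_ifs <;> ring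

/-- The eigenvalue equation of a minimizer in weak form. -/
theorem sum_uLin_mul_uLin {n N : ℕ} (hN : 3 ≤ N) (hNn : N ≤ n) {a : Fin n → ℝ}
    (ha : uForm hN hNn a = (uGraph n (n - N) 3).qMin * ∑ i, a i ^ 2) (h : Fin n → ℝ) :
    ∑ j, uLin hN hNn j a * uLin hN hNn j h =
      (uGraph n (n - N) 3).qMin * ∑ j, a j * h j := by
  set q := (uGraph n (n - N) 3).qMin
  set B := ∑ j, uLin hN hNn j a * uLin hN hNn j h with hB
  set C := ∑ j, a j * h j with hC
  have h1 : ∀ t : ℝ, 0 ≤ 2 * t * (B - q * C) + t ^ 2 * (uForm hN hNn h - q * ∑ i, h i ^ 2) := by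
    intro t
    have h2 := qMin_uGraph_le hN hNn (fun i => a i + t * h i)
    have h3 : uForm hN hNn (fun i => a i + t * h i) =
        uForm hN hNn a + 2 * t * B + t ^ 2 * uForm hN hNn h := by
      simp only [uForm, uLin_add_mul, hB, Finset.mul_sum, ← Finset.sum_add_distrib]
      exact Finset.sum_congr rfl fun _ _ => by ring
    have h4 : ∑ i, (a i + t * h i) ^ 2 =
        ∑ i, a i ^ 2 + 2 * t * C + t ^ 2 * ∑ i, h i ^ 2 := by
      simp only [hC, Finset.mul_sum, ← Finset.sum_add_distrib]
      exact Finset.sum_congr rfl fun _ _ => by ring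
    rw [h3, h4, ha] at h2
    linarith
  generalize uForm hN hNn h - q * ∑ i, h i ^ 2 = D at h1
  by_contra hne
  set b := B - q * C with hb
  have hb0 : b ≠ 0 := sub_ne_zero.2 hne
  have h5 := h1 (-b / (|D| + 1))
  have hD : 0 < |D| + 1 := by positivity
  have h6 : 2 * (-b / (|D| + 1)) * b + (-b / (|D| + 1)) ^ 2 * D =
      b ^ 2 / (|D| + 1) ^ 2 * (D - 2 * (|D| + 1)) := by
    field_simp
    ring
  rw [h6] at h5
  have h7 : D - 2 * (|D| + 1) < 0 := by linarith [le_abs_self D, abs_nonneg D]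
  have h8 : 0 < b ^ 2 / (|D| + 1) ^ 2 := by positivity
  nlinarith [mul_neg_of_pos_of_neg h8 h7]

theorem uPartner_ne_last {n N : ℕ} (hN : 3 ≤ N) (hNn : N ≤ n) (hn : 4 ≤ n) (j : Fin n) :
    (uPartner hN hNn j : ℕ) ≠ n - 1 := by
  rw [uPartner_val]
  have := j.2
  split_ifs <;> omega

theorem qMin_uGraph_lt_one {n N : ℕ} (hN : 3 ≤ N) (hNn : N ≤ n) (hn : 4 ≤ n) :
    (uGraph n (n - N) 3).qMin < 1 := by
  set q := (uGraph n (n - N) 3).qMin with hq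
  set l : Fin n := ⟨n - 1, by omega⟩ with hl
  set a : Fin n → ℝ := fun j => if j = l then 1 else 0 with ha
  have hL : ∀ j, uLin hN hNn j a = if j = l then 1 else 0 := by
    intro j
    have h1 : a (uPartner hN hNn j) = 0 :=
      if_neg fun h => uPartner_ne_last hN hNn hn j (congrArg Fin.val h)
    simp only [uLin, h1, add_zero, sub_zero, ite_self]
    rfl
  have hF : uForm hN hNn a = 1 := by
    simp [uForm, hL]
  have hS : ∑ i, a i ^ 2 = 1 := by
    simp [ha]
  have hle := qMin_uGraph_le hN hNn a
  rw [hF, hS, mul_one] at hle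
  refine lt_of_le_of_ne hle fun h => ?_
  have h1 := sum_uLin_mul_uLin hN hNn (a := a) (by rw [hF, hS, mul_one, ← hq, h])
    (fun j => if j = uPartner hN hNn l then 1 else 0)
  have h2 : l ≠ uPartner hN hNn l := fun h' =>
    uPartner_ne_last hN hNn hn l (congrArg Fin.val h'.symm)
  have h3 : (l : ℕ) ≠ 1 := by simp only [hl]; omega
  simp only [hL, ite_mul, one_mul, zero_mul, Finset.sum_ite_eq', Finset.mem_univ, if_true] at h1
  simp [ha, uLin, h2, h2.symm, h3] at h1

theorem stationary_zero_eq_one {n N : ℕ} (hN : 3 ≤ N) (hNn : N ≤ n) {a : Fin n → ℝ}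
    (ha : uForm hN hNn a = (uGraph n (n - N) 3).qMin * ∑ i, a i ^ 2) (hn : 4 ≤ n) :
    a ⟨0, by omega⟩ = a ⟨1, by omega⟩ := by
  have h := sum_uLin_mul_uLin hN hNn ha
    (fun j => if (j : ℕ) = 0 then 1 else if (j : ℕ) = 1 then -1 else 0)
  rw [Fintype.sum_eq_add (⟨0, by omega⟩ : Fin n) ⟨2, by omega⟩ (by simp),
    Fintype.sum_eq_add (⟨0, by omega⟩ : Fin n) ⟨1, by omega⟩ (by simp)] at h
  · have h2 : uPartner hN hNn ⟨2, by omega⟩ = ⟨1, by omega⟩ := by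
      rw [Fin.ext_iff, uPartner_val]; simp; omega
    have h0 : uPartner hN hNn ⟨0, by omega⟩ = ⟨2, by omega⟩ := by
      rw [Fin.ext_iff, uPartner_val]; simp
    simp only [uLin, h2, h0] at h
    norm_num at h
    have hq := qMin_uGraph_lt_one hN hNn hn
    have h3 : (1 - (uGraph n (n - N) 3).qMin) * (a ⟨0, by omega⟩ - a ⟨1, by omega⟩) = 0 := by
      linear_combination h
    rcases mul_eq_zero.1 h3 with h4 | h4
    · linarith
    · linarith
  · rintro j ⟨h1, h2⟩
    simp only [ne_eq, Fin.ext_iff] at h1 h2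
    simp [h1, h2]
  · rintro j ⟨h1, h2⟩
    simp only [ne_eq, Fin.ext_iff] at h1 h2
    simp only [uLin, uPartner_val]
    split_ifs <;> first | omega | simp

theorem stationary_two_eq {n N : ℕ} (hN : 3 ≤ N) (hNn : N ≤ n) {a : Fin n → ℝ}
    (ha : uForm hN hNn a = (uGraph n (n - N) 3).qMin * ∑ i, a i ^ 2) :
    a ⟨0, by omega⟩ + a ⟨1, by omega⟩ + (a ⟨0, by omega⟩ - a ⟨2, by omega⟩) =
      (uGraph n (n - N) 3).qMin * a ⟨0, by omega⟩ := by
  have h := sum_uLin_mul_uLin hN hNn ha (fun j => if (j : ℕ) = 0 then 1 else 0)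
  rw [Fintype.sum_eq_add (⟨0, by omega⟩ : Fin n) ⟨1, by omega⟩ (by simp),
    Fintype.sum_eq_single (⟨0, by omega⟩ : Fin n)] at h
  · have h1 : uPartner hN hNn ⟨1, by omega⟩ = ⟨0, by omega⟩ := by
      rw [Fin.ext_iff, uPartner_val]; simp; omega
    have h0 : uPartner hN hNn ⟨0, by omega⟩ = ⟨2, by omega⟩ := by
      rw [Fin.ext_iff, uPartner_val]; simp
    simp only [uLin, h1, h0] at h
    norm_num at h
    linear_combination h
  · intro j h1
    simp only [ne_eq, Fin.ext_iff] at h1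
    simp [h1]
  · rintro j ⟨h1, h2⟩
    simp only [ne_eq, Fin.ext_iff] at h1 h2
    simp only [uLin, uPartner_val]
    split_ifs <;> first | omega | simp

theorem stationary_leaf {n N : ℕ} (hN : 3 ≤ N) (hNn : N ≤ n) {a : Fin n → ℝ}
    (ha : uForm hN hNn a = (uGraph n (n - N) 3).qMin * ∑ i, a i ^ 2) {j : Fin n} (hj : N ≤ j) :
    a j - a ⟨N - 1, by omega⟩ = (uGraph n (n - N) 3).qMin * a j := by
  have h := sum_uLin_mul_uLin hN hNn ha (fun i => if i = j then 1 else 0)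
  have hp : ∀ i, uPartner hN hNn i ≠ j := by
    intro i h
    have := congrArg Fin.val h
    rw [uPartner_val] at this
    have := i.2
    split_ifs at * <;> omega
  have hj1 : (j : ℕ) ≠ 1 := by omega
  have hpj : uPartner hN hNn j = ⟨N - 1, by omega⟩ := by
    rw [Fin.ext_iff, uPartner_val]
    split_ifs <;> simp <;> omega
  rw [Fintype.sum_eq_single j, Fintype.sum_eq_single j] at h
  · have hne : (⟨N - 1, by omega⟩ : Fin n) ≠ j := hpj ▸ hp j
    simpa [uLin, hp, hj1, hpj, hne] using h
  · intro i hi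
    simp [hi]
  · intro i hi
    simp [uLin, hp, hi]

theorem stationary_two_flux {n N : ℕ} (hN : 3 ≤ N) (hNn : N ≤ n) {a : Fin n → ℝ}
    (ha : uForm hN hNn a = (uGraph n (n - N) 3).qMin * ∑ i, a i ^ 2) :
    2 * a ⟨2, by omega⟩ - a ⟨0, by omega⟩ - a ⟨1, by omega⟩ =
      (uGraph n (n - N) 3).qMin * ∑ l ∈ Finset.univ.filter (fun l : Fin n => 2 ≤ (l : ℕ)), a l := by
  have h := sum_uLin_mul_uLin hN hNn ha (fun i => if 2 ≤ (i : ℕ) then 1 else 0)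
  rw [Fintype.sum_eq_add (⟨0, by omega⟩ : Fin n) ⟨2, by omega⟩ (by simp)] at h
  · have h2 : uPartner hN hNn ⟨2, by omega⟩ = ⟨1, by omega⟩ := by
      rw [Fin.ext_iff, uPartner_val]; simp; omega
    have h0 : uPartner hN hNn ⟨0, by omega⟩ = ⟨2, by omega⟩ := by
      rw [Fin.ext_iff, uPartner_val]; simp
    simp only [uLin, h2, h0, mul_ite, mul_one, mul_zero, ← Finset.sum_filter] at h
    norm_num at h
    linear_combination h
  · rintro j ⟨h1, h2⟩
    simp only [ne_eq, Fin.ext_iff] at h1 h2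
    simp only [uLin, uPartner_val]
    split_ifs <;> first | omega | simp

theorem stationary_flux {n N : ℕ} (hN : 3 ≤ N) (hNn : N ≤ n) {a : Fin n → ℝ}
    (ha : uForm hN hNn a = (uGraph n (n - N) 3).qMin * ∑ i, a i ^ 2) {j : Fin n}
    (hj3 : 3 ≤ (j : ℕ)) (hjN : (j : ℕ) < N) :
    a j - a ⟨j - 1, by omega⟩ =
      (uGraph n (n - N) 3).qMin * ∑ l ∈ Finset.univ.filter (fun l : Fin n => (j : ℕ) ≤ l), a l := by
  have h := sum_uLin_mul_uLin hN hNn ha (fun i => if (j : ℕ) ≤ i then 1 else 0)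
  have hpj : uPartner hN hNn j = ⟨j - 1, by omega⟩ := by
    rw [Fin.ext_iff, uPartner_val]
    split_ifs <;> simp <;> omega
  have hj1 : (j : ℕ) ≠ 1 := by omega
  have hj2 : ¬ (j : ℕ) ≤ j - 1 := by omega
  rw [Fintype.sum_eq_single j] at h
  · simpa [uLin, hpj, hj1, hj2, Finset.sum_filter] using h
  · intro i hi
    simp only [ne_eq, Fin.ext_iff] at hi
    simp only [uLin, uPartner_val]
    split_ifs <;> first | omega | simp

theorem stationary_zero_ne_zero {n N : ℕ} (hN : 3 ≤ N) (hNn : N ≤ n) {a : Fin n → ℝ}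
    (ha : uForm hN hNn a = (uGraph n (n - N) 3).qMin * ∑ i, a i ^ 2) (hn : 4 ≤ n) (ha0 : a ≠ 0) (hq : 0 < (uGraph n (n - N) 3).qMin)
    (hnn : (∀ i, 0 ≤ a i) ∨ N = 3) : a ⟨0, by omega⟩ ≠ 0 := by
  intro h0
  have h1 := stationary_zero_eq_one hN hNn ha hn
  have h2 := stationary_two_eq hN hNn ha
  have h3 := stationary_two_flux hN hNn ha
  rw [← h1, h0] at h2 h3
  have h4 : a ⟨2, by omega⟩ = 0 := by linarith
  apply ha0
  funext j
  rcases hnn with hnn | rfl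
  · have h5 : ∑ l ∈ Finset.univ.filter (fun l : Fin n => 2 ≤ (l : ℕ)), a l = 0 := by
      rw [h4] at h3
      have : (uGraph n (n - N) 3).qMin * ∑ l ∈ Finset.univ.filter (fun l : Fin n => 2 ≤ (l : ℕ)), a l = 0 := by linarith
      exact (mul_eq_zero.1 this).resolve_left hq.ne'
    rcases Nat.lt_or_ge j 2 with h | h
    · interval_cases h' : (j : ℕ)
      · rw [show j = ⟨0, by omega⟩ from Fin.ext h']; exact h0
      · rw [show j = ⟨1, by omega⟩ from Fin.ext h']; exact h1 ▸ h0
    · exact (Finset.sum_eq_zero_iff_of_nonneg fun i _ => hnn i).1 h5 j (by simpa using h)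
  · rcases Nat.lt_or_ge j 3 with h | h
    · interval_cases h' : (j : ℕ)
      · rw [show j = ⟨0, by omega⟩ from Fin.ext h']; exact h0
      · rw [show j = ⟨1, by omega⟩ from Fin.ext h']; exact h1 ▸ h0
      · rw [show j = ⟨2, by omega⟩ from Fin.ext h']; exact h4
    · have h5 := stationary_leaf hN hNn ha h
      simp only [Nat.reduceSub] at h5
      rw [h4] at h5
      have h6 := qMin_uGraph_lt_one hN hNn hn
      have : (1 - (uGraph n (n - 3) 3).qMin) * a j = 0 := by linarith
      exact (mul_eq_zero.1 this).resolve_left (by linarith)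

/-- The edges joining every vertex outside `S` to its image under a map to `S` form a forest. -/
theorem exists_isAcyclic_of_map {V : Type*} {G : SimpleGraph V} {S : Finset V} {σ : V → V}
    (hσ : ∀ w, w ∉ S → σ w ∈ S ∧ G.Adj w (σ w)) :
    ∃ F : SimpleGraph V, F ≤ G ∧ F.IsAcyclic ∧ ∀ w, w ∉ S → F.Adj w (σ w) := by
  classical
  let F : SimpleGraph V := fromRel fun a b => a ∉ S ∧ b = σ a
  have hadj : ∀ a b, F.Adj a b → (a ∉ S ∧ b = σ a) ∨ (b ∉ S ∧ a = σ b) := fun a b h =>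
    ((fromRel_adj _ _ _).1 h).2
  refine ⟨F, ?_, ?_, fun w hw => ?_⟩
  · intro a b h
    rcases hadj a b h with ⟨h1, rfl⟩ | ⟨h1, rfl⟩
    · exact (hσ a h1).2
    · exact (hσ b h1).2.symm
  · have key : ∀ w, w ∉ S → ∀ c : F.Walk w w, ¬ c.IsCycle := by
      intro w hw c hc
      have h1 : ∀ y, F.Adj w y → y = σ w := by
        intro y hy
        rcases hadj w y hy with ⟨-, h⟩ | ⟨h2, h⟩
        · exact h
        · exact absurd (h ▸ (hσ y h2).1) hw
      have h2 := h1 _ (c.adj_snd hc.not_nil)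
      have h3 := h1 _ (c.adj_penultimate hc.not_nil).symm
      exact hc.snd_ne_penultimate (h2.trans h3.symm)
    intro v c hc
    by_cases hv : v ∈ S
    · have h1 := c.adj_snd hc.not_nil
      have h2 : c.snd ∉ S := by
        rcases hadj _ _ h1 with ⟨h, -⟩ | ⟨h, -⟩
        · exact absurd hv h
        · exact h
      have h3 : c.snd ∈ c.support := c.getVert_mem_support 1
      exact key _ h2 _ (hc.rotate h3)
    · exact key v hv c hc
  · exact (fromRel_adj _ _ _).2 ⟨(hσ w hw).2.ne, Or.inl ⟨hw, rfl⟩⟩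

/-- A path in a bipartite graph along which `s` is not a proper coloring has a monochromatic edge
that it traverses exactly once. -/
theorem exists_edge_of_isPath {V : Type*} {T : SimpleGraph V} {κ : V → Bool}
    (hκ : ∀ i j, T.Adj i j → κ i ≠ κ j) (s : V → Bool) {a b : V} (p : T.Walk a b)
    (hp : p.IsPath) : (κ a = κ b ↔ s a = s b) ∨
      ∃ i j, i ∈ p.support ∧ j ∈ p.support ∧ T.Adj i j ∧ s i = s j ∧
        (T.deleteEdges {s(i, j)}).Reachable a i ∧ (T.deleteEdges {s(i, j)}).Reachable j b := by
  induction p with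
  | nil => simp
  | @cons a c b h p ih =>
    rw [Walk.cons_isPath_iff] at hp
    by_cases hx : s a = s c
    · refine Or.inr ⟨a, c, by simp, by simp, h, hx, Reachable.refl a, ?_⟩
      refine ⟨p.toDeleteEdges {s(a, c)} fun e he he' => ?_⟩
      rw [Set.mem_singleton_iff] at he'
      subst he'
      exact hp.2 (p.fst_mem_support_of_mem_edges he)
    · rcases ih hp.1 with h1 | ⟨i, j, hi, hj, hij, hx', h1, h2⟩
      · left
        have hac := hκ a c h
        revert hac h1 hx
        cases κ a <;> cases κ b <;> cases κ c <;> cases s a <;> cases s b <;> cases s c <;> simp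
      · refine Or.inr ⟨i, j, by simp [hi], by simp [hj], hij, hx', ?_, h2⟩
        refine Reachable.trans (Adj.reachable ?_) h1
        rw [deleteEdges_adj]
        refine ⟨h, fun h3 => ?_⟩
        rw [Set.mem_singleton_iff, Sym2.eq_iff] at h3
        rcases h3 with ⟨rfl, -⟩ | ⟨rfl, -⟩
        · exact hp.2 hi
        · exact hp.2 hj

/-- A connected non-bipartite graph with a star forest and a sign function has an edge `uv` with
equal signs at its ends and a spanning connected bipartite subgraph `H`, in which `u` and `v` lie
in the same class, such that the forest is contained in `H` together with `uv`. -/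
theorem exists_connected_bipartite_le {V : Type*} {G : SimpleGraph V} (hconn : G.Connected)
    (hbip : ¬ G.IsBipartite) {S : Finset V} {σ : V → V}
    (hσ : ∀ w, w ∉ S → σ w ∈ S ∧ G.Adj w (σ w)) (s : V → Bool) :
    ∃ (H : SimpleGraph V) (κ : V → Bool) (u v : V), H ≤ G ∧ H.Connected ∧
      (∀ i j, H.Adj i j → κ i ≠ κ j) ∧ G.Adj u v ∧ κ u = κ v ∧ s u = s v ∧
      ∀ w, w ∉ S → H.Adj w (σ w) ∨ s(w, σ w) = s(u, v) := by
  classical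
  obtain ⟨F, hFG, hFa, hF⟩ := exists_isAcyclic_of_map hσ
  obtain ⟨T, hFT, hTG, hT⟩ := hconn.exists_isTree_le_of_le_of_isAcyclic hFG hFa
  obtain ⟨κ, hκ⟩ := exists_bool_coloring_of_isBipartite hT.isBipartite
  obtain ⟨a, b, hab, hκab⟩ : ∃ a b, G.Adj a b ∧ κ a = κ b := by
    by_contra! h
    exact hbip (isBipartite_of_bool_coloring κ h)
  by_cases hs : s a = s b
  · exact ⟨T, κ, a, b, hTG, hT.1, hκ, hab, hκab, hs, fun w hw => Or.inl (hFT (hF w hw))⟩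
  obtain ⟨p, hp⟩ := (hT.1 a b).exists_isPath
  rcases exists_edge_of_isPath hκ s p hp with h | ⟨i, j, -, -, hij, hsij, hai, hjb⟩
  · exact absurd (h.1 hκab) hs
  set T' := T.deleteEdges {s(i, j)} with hT'
  have hbr : ¬ T'.Reachable i j := by
    have := isAcyclic_iff_forall_adj_isBridge.1 hT.2 hij
    rwa [isBridge_iff] at this
  have hT'T : T' ≤ T := deleteEdges_le _
  have hHadj : ∀ y z, (T' ⊔ edge a b).Adj y z ↔ T'.Adj y z ∨ (s(a, b) = s(y, z) ∧ y ≠ z) := by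
    intro y z
    rw [sup_adj, edge_adj, Sym2.eq_iff]
    tauto
  have hT'adj : ∀ y z, T.Adj y z → T'.Adj y z ∨ s(y, z) = s(i, j) := by
    intro y z h
    rw [hT', deleteEdges_adj, Set.mem_singleton_iff]
    tauto
  have hle : T' ≤ T' ⊔ edge a b := le_sup_left
  have hreach : (T' ⊔ edge a b).Reachable i j :=
    ((hai.mono hle).symm.trans (Adj.reachable ((hHadj a b).2 (Or.inr ⟨rfl, hab.ne⟩)))).trans
      (hjb.mono hle).symm
  refine ⟨T' ⊔ edge a b, fun w => if T'.Reachable j w then !κ w else κ w, i, j, ?_, ?_, ?_,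
    hTG hij, ?_, hsij, ?_⟩
  · intro y z h
    rcases (hHadj y z).1 h with h | ⟨h, -⟩
    · exact hTG (hT'T h)
    · rwa [← mem_edgeSet, ← h, mem_edgeSet]
  · have : Nonempty V := hT.1.nonempty
    refine ⟨fun y z => ?_⟩
    obtain ⟨p⟩ := hT.1 y z
    induction p with
    | nil => exact Reachable.refl _
    | cons h p ih =>
      refine Reachable.trans ?_ ih
      rcases hT'adj _ _ h with h | h
      · exact (h.reachable).mono hle
      · rcases Sym2.eq_iff.1 h with ⟨rfl, rfl⟩ | ⟨rfl, rfl⟩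
        · exact hreach
        · exact hreach.symm
  · have hflip : ∀ y z, T'.Reachable j y → ¬ T'.Reachable j z → κ y = κ z →
        (if T'.Reachable j y then !κ y else κ y) ≠ (if T'.Reachable j z then !κ z else κ z) := by
      intro y z h1 h2 h3
      rw [if_pos h1, if_neg h2, h3]
      simp
    have ha : ¬ T'.Reachable j a := fun h => hbr (h.trans hai).symm
    intro y z h
    rcases (hHadj y z).1 h with h | ⟨h, -⟩
    · have h1 : T'.Reachable j y ↔ T'.Reachable j z :=
        ⟨fun h' => h'.trans h.reachable, fun h' => h'.trans h.reachable.symm⟩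
      have h2 := hκ y z (hT'T h)
      by_cases h3 : T'.Reachable j z
      · simpa [h1, h3] using h2
      · simpa [h1, h3] using h2
    · rcases Sym2.eq_iff.1 h with ⟨rfl, rfl⟩ | ⟨rfl, rfl⟩
      · exact (hflip _ _ hjb ha hκab.symm).symm
      · exact hflip _ _ hjb ha hκab.symm
  · simp only [Reachable.refl, if_true]
    rw [if_neg fun h => hbr h.symm]
    have := hκ i j hij
    revert this
    cases κ i <;> cases κ j <;> simp
  · intro w hw
    rcases hT'adj _ _ (hFT (hF w hw)) with h | h
    · exact Or.inl (hle h)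
    · exact Or.inr h

/-- From every star of a star forest with centers `S` (the vertices outside `T` are the leaves,
`σ` maps them to their centers) select a lowest leaf and, if the center is not `c`, a highest leaf.
If the center is lowest, then a prescribed leaf `z` can be selected as well. -/
theorem exists_star_selection {V : Type*} [Fintype V] [DecidableEq V] (f : V → ℝ) {S T : Finset V}
    {σ : V → V} (hσ : ∀ w, w ∉ T → σ w ∈ S) {c : V} (hc : c ∈ S) (hT : T.card ≤ S.card + 1)
    (z : V) :
    ∃ K : Finset V, T ⊆ K ∧ K.card = min (Fintype.card V) (3 * S.card) ∧
      (∀ w, w ∉ K → ∃ m ∈ K, m ∉ T ∧ σ m = σ w ∧ (f m ≤ f w ∨ f (σ w) ≤ f w)) ∧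
      (∀ w, w ∉ K → σ w ≠ c → ∃ m ∈ K, m ∉ T ∧ σ m = σ w ∧ f w ≤ f m) ∧
      (z ∉ T → z ∈ K ∨ ∃ m ∈ K, m ∉ T ∧ σ m = σ z ∧ f m < f (σ z)) := by
  have hlo : ∀ s, ∃ m, ∀ w, w ∉ T → σ w = s → m ∉ T ∧ σ m = s ∧ (f m ≤ f w ∨ f s ≤ f w) ∧
      (w = z → m = z ∨ f m < f s) := by
    intro s
    by_cases hs : ∃ w, w ∉ T ∧ σ w = s
    · obtain ⟨m, hm, hmin⟩ := Finset.exists_min_image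
        (Finset.univ.filter fun w => w ∉ T ∧ σ w = s) f
        (by obtain ⟨w, hw⟩ := hs; exact ⟨w, by simpa using hw⟩)
      simp only [Finset.mem_filter, Finset.mem_univ, true_and] at hm hmin
      rcases lt_or_ge (f m) (f s) with h | h
      · exact ⟨m, fun w hw hws => ⟨hm.1, hm.2, Or.inl (hmin w ⟨hw, hws⟩), fun _ => Or.inr h⟩⟩
      · by_cases hz : z ∉ T ∧ σ z = s
        · exact ⟨z, fun w hw hws => ⟨hz.1, hz.2, Or.inr (h.trans (hmin w ⟨hw, hws⟩)),
            fun _ => Or.inl rfl⟩⟩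
        · exact ⟨m, fun w hw hws => ⟨hm.1, hm.2, Or.inl (hmin w ⟨hw, hws⟩),
            fun hwz => absurd (hwz ▸ ⟨hw, hws⟩) hz⟩⟩
    · exact ⟨s, fun w hw hws => absurd ⟨w, hw, hws⟩ hs⟩
  have hhi : ∀ s, ∃ m, ∀ w, w ∉ T → σ w = s → m ∉ T ∧ σ m = s ∧ f w ≤ f m := by
    intro s
    by_cases hs : ∃ w, w ∉ T ∧ σ w = s
    · obtain ⟨m, hm, hmax⟩ := Finset.exists_max_image
        (Finset.univ.filter fun w => w ∉ T ∧ σ w = s) f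
        (by obtain ⟨w, hw⟩ := hs; exact ⟨w, by simpa using hw⟩)
      simp only [Finset.mem_filter, Finset.mem_univ, true_and] at hm hmax
      exact ⟨m, fun w hw hws => ⟨hm.1, hm.2, hmax w ⟨hw, hws⟩⟩⟩
    · exact ⟨s, fun w hw hws => absurd ⟨w, hw, hws⟩ hs⟩
  choose lo hlo using hlo
  choose hi hhi using hhi
  have hcard : (T ∪ S.image lo ∪ (S.erase c).image hi).card ≤
      min (Fintype.card V) (3 * S.card) := by
    refine le_min (Finset.card_le_univ _) ?_
    have h1 := Finset.card_union_le (T ∪ S.image lo) ((S.erase c).image hi)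
    have h2 := Finset.card_union_le T (S.image lo)
    have h3 : (S.image lo).card ≤ S.card := Finset.card_image_le
    have h4 : ((S.erase c).image hi).card ≤ (S.erase c).card := Finset.card_image_le
    rw [Finset.card_erase_of_mem hc] at h4
    have h5 := Finset.card_pos.2 ⟨c, hc⟩
    omega
  obtain ⟨K, hK, -, hKc⟩ := Finset.exists_subsuperset_card_eq (Finset.subset_univ _) hcard
    (by rw [Finset.card_univ]; exact min_le_left _ _)
  have hTK : T ⊆ K := fun w hw => hK (by simp [hw])
  have hloK : ∀ w, w ∉ T → lo (σ w) ∈ K := fun w hw =>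
    hK (Finset.mem_union_left _ (Finset.mem_union_right _ (Finset.mem_image_of_mem _ (hσ w hw))))
  refine ⟨K, hTK, hKc, fun w hw => ?_, fun w hw hwc => ?_, fun hz => ?_⟩
  · have hwT : w ∉ T := fun h => hw (hTK h)
    obtain ⟨h1, h2, h3, -⟩ := hlo _ w hwT rfl
    exact ⟨_, hloK w hwT, h1, h2, h3⟩
  · have hwT : w ∉ T := fun h => hw (hTK h)
    obtain ⟨h1, h2, h3⟩ := hhi _ w hwT rfl
    exact ⟨_, hK (Finset.mem_union_right _ (Finset.mem_image_of_mem _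
      (Finset.mem_erase.2 ⟨hwc, hσ w hwT⟩))), h1, h2, h3⟩
  · obtain ⟨h1, h2, -, h3⟩ := hlo _ z hz rfl
    rcases h3 rfl with h3 | h3
    · exact Or.inl (h3 ▸ hloK z hz)
    · exact Or.inr ⟨_, hloK z hz, h1, h2, h3⟩

/-- A set `K` of `N` elements can be enumerated in the order of `f`, followed by all other
elements of the type. -/
theorem exists_sorted_equiv {V : Type*} [Fintype V] {n N : ℕ} (hn : Fintype.card V = n)
    (f : V → ℝ) (K : Finset V) (hK : K.card = N) :
    ∃ φ : Fin n ≃ V, (∀ i, φ i ∈ K ↔ (i : ℕ) < N) ∧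
      ∀ i j : Fin n, i ≤ j → (j : ℕ) < N → f (φ i) ≤ f (φ j) := by
  classical
  subst hn
  set e := (Fintype.equivFin V).symm
  obtain ⟨M, hM⟩ : ∃ M, ∀ w, f w < M := by
    obtain ⟨M, hM⟩ := (Set.finite_range f).bddAbove
    exact ⟨M + 1, fun w => lt_of_le_of_lt (hM ⟨w, rfl⟩) (lt_add_one M)⟩
  set g : V → ℝ := fun w => if w ∈ K then f w else M with hg
  set φ : Fin (Fintype.card V) ≃ V := (Tuple.sort (g ∘ e)).trans e with hφ
  have hmono : Monotone (g ∘ φ) := Tuple.monotone_sort (g ∘ e)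
  have hlow : ∀ i j, i ≤ j → φ j ∈ K → φ i ∈ K := by
    intro i j hij hj
    by_contra hi
    have := hmono hij
    simp only [Function.comp, hg, hj, hi, if_true, if_false] at this
    exact absurd (hM (φ j)) (not_lt.2 this)
  set A : Finset (Fin (Fintype.card V)) := Finset.univ.filter fun i => φ i ∈ K with hA
  have hAc : A.card = N := by
    rw [← hK]
    refine Finset.card_bij (fun i _ => φ i) (fun i hi => by simpa [hA] using hi)
      (fun i _ j _ h => φ.injective h) fun w hw => ⟨φ.symm w, by simpa [hA] using hw, by simp⟩
  have hmem : ∀ i, φ i ∈ K ↔ (i : ℕ) < N := by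
    intro i
    constructor
    · intro hi
      have h1 : Finset.Iic i ⊆ A := fun j hj => by
        simpa [hA] using hlow j i (Finset.mem_Iic.1 hj) hi
      have := Finset.card_le_card h1
      rw [hAc, Fin.card_Iic] at this
      omega
    · intro hi
      by_contra h
      have h1 : A ⊆ Finset.Iio i := fun j hj => by
        rw [Finset.mem_Iio]
        by_contra hij
        exact h (hlow i j (not_lt.1 hij) (by simpa [hA] using hj))
      have := Finset.card_le_card h1
      rw [hAc, Fin.card_Iio] at this
      omega
  refine ⟨φ, hmem, fun i j hij hj => ?_⟩
  have h1 := (hmem j).2 hj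
  have h2 := hmono hij
  simpa only [Function.comp, hg, h1, hlow i j hij h1, if_true] using h2

/-- A spanning connected bipartite subgraph `H` of `G`, an edge `uv` of `G` inside a class of `H`,
a star forest in `H` with centers `S` and leaves outside `S` and `v`, and a selection `K` of `N`
vertices, enumerated in the order of `f`, that represents the stars sufficiently well. -/
structure StarFrame {V : Type*} (G : SimpleGraph V) (f : V → ℝ) (n N : ℕ) where
  H : SimpleGraph V
  κ : V → Bool
  u : V
  v : V
  S : Finset V
  K : Finset V
  σ : V → V
  c : V
  φ : Fin n ≃ V
  le : H ≤ G
  conn : H.Connected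
  col : ∀ i j, H.Adj i j → κ i ≠ κ j
  adj : G.Adj u v
  col_eq : κ u = κ v
  v_mem : v ∈ K
  S_sub : S ⊆ K
  c_mem : c ∈ S
  c_max : ∀ s ∈ S, f s ≤ f c
  σ_mem : ∀ w, w ∉ S → w ≠ v → σ w ∈ S
  σ_adj : ∀ w, w ∉ S → w ≠ v → H.Adj w (σ w)
  low : ∀ w, w ∉ K → ∃ m ∈ K, (m ∉ S ∧ m ≠ v) ∧ σ m = σ w ∧ (f m ≤ f w ∨ f (σ w) ≤ f w)
  high : ∀ w, w ∉ K → σ w ≠ c → ∃ m ∈ K, (m ∉ S ∧ m ≠ v) ∧ σ m = σ w ∧ f w ≤ f m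
  special :
    (u ∈ S ∧
      (∀ y, y ∉ K → H.Adj v y → σ y = u → (∃ z, H.Adj v z ∧ z ≠ u ∧ (z ∈ K ∨
        ∃ m ∈ K, (m ∉ S ∧ m ≠ v) ∧ σ m = u ∧ f m < f u))) ∧
      (∀ y, y ∉ K → H.Adj u y → σ y = v → (∃ m, (m ∉ S ∧ m ≠ v) ∧ σ m = u) ∨
        (∃ z, H.Adj u z ∧ z ≠ v ∧ (z ∈ K ∨
        ∃ m ∈ K, (m ∉ S ∧ m ≠ v) ∧ σ m = v ∧ f m < f v)))) ∨
    (u ∉ S ∧ v ∉ S ∧ (u ∈ K ∨ ∃ m ∈ K, (m ∉ S ∧ m ≠ v) ∧ σ m = σ u ∧ f m < f (σ u)))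
  mem_iff : ∀ i, φ i ∈ K ↔ (i : ℕ) < N
  mono : ∀ i j : Fin n, i ≤ j → (j : ℕ) < N → f (φ i) ≤ f (φ j)
  hN : 4 ≤ N
  hNn : N ≤ n

/-- The interval between the values of `f` at the ends of an edge. -/
def edgeInterval {V : Type*} (f : V → ℝ) : Sym2 V → Set ℝ :=
  Sym2.lift ⟨fun i j => Set.uIoc (f i) (f j), fun _ _ => Set.uIoc_comm _ _⟩

theorem Ioc_subset_edgeInterval {V : Type*} {f : V → ℝ} {i j : V} {l h : ℝ} (hi : f i ≤ l)
    (hj : h ≤ f j) : Set.Ioc l h ⊆ edgeInterval f s(i, j) := fun _ hx =>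
  ⟨lt_of_le_of_lt ((min_le_left _ _).trans hi) hx.1, hx.2.trans (hj.trans (le_max_right _ _))⟩

namespace StarFrame

variable {V : Type*} {G : SimpleGraph V} {f : V → ℝ} {n N : ℕ} (F : StarFrame G f n N)

/-- An edge of `H` other than the star edges at the leaves outside `K`. -/
def Kept (e : Sym2 V) : Prop := e ∈ F.H.edgeSet ∧ ∀ w, w ∉ F.K → e ≠ s(w, F.σ w)

/-- The `i`-th selected vertex, for `i < N`. -/
def pt (i : ℕ) (hi : i < N) : V := F.φ ⟨i, hi.trans_le F.hNn⟩

theorem pt_mem (i : ℕ) (hi : i < N) : F.pt i hi ∈ F.K := (F.mem_iff _).2 hi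

theorem exists_pt {w : V} (hw : w ∈ F.K) : ∃ i, ∃ hi : i < N, F.pt i hi = w :=
  ⟨F.φ.symm w, (F.mem_iff _).1 (by simpa using hw), by simp [pt]⟩

theorem pt_mono {i j : ℕ} (hij : i ≤ j) (hj : j < N) :
    f (F.pt i (hij.trans_lt hj)) ≤ f (F.pt j hj) := F.mono _ _ hij hj

theorem pt_inj {i j : ℕ} {hi : i < N} {hj : j < N} (h : F.pt i hi = F.pt j hj) : i = j := by
  have := F.φ.injective h
  simpa using this

theorem σ_mem_K {w : V} (hw : w ∉ F.K) : F.σ w ∈ F.K :=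
  F.S_sub (F.σ_mem w (fun h => hw (F.S_sub h)) fun h => hw (h ▸ F.v_mem))

theorem σ_mem_S {w : V} (hw : w ∉ F.K) : F.σ w ∈ F.S :=
  F.σ_mem w (fun h => hw (F.S_sub h)) fun h => hw (h ▸ F.v_mem)

theorem σ_adj' {w : V} (hw : w ∉ F.K) : F.H.Adj w (F.σ w) :=
  F.σ_adj w (fun h => hw (F.S_sub h)) fun h => hw (h ▸ F.v_mem)

theorem kept_star {m : V} (hm : m ∈ F.K) (hmS : m ∉ F.S) (hmv : m ≠ F.v) :
    F.Kept s(m, F.σ m) := by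
  refine ⟨F.σ_adj m hmS hmv, fun w hw h => ?_⟩
  rcases Sym2.eq_iff.1 h with ⟨h1, -⟩ | ⟨-, h1⟩
  · exact hw (h1 ▸ hm)
  · exact hw (h1 ▸ F.S_sub (F.σ_mem m hmS hmv))

theorem kept_of_adj {i j : V} (h : F.H.Adj i j) (hi : i ∉ F.K → j ≠ F.σ i)
    (hj : j ∉ F.K → i ≠ F.σ j) : F.Kept s(i, j) := by
  refine ⟨h, fun w hw h' => ?_⟩
  rcases Sym2.eq_iff.1 h' with ⟨rfl, h1⟩ | ⟨h1, rfl⟩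
  · exact hi hw h1
  · exact hj hw h1

theorem not_adj_uv : ¬ F.H.Adj F.u F.v := fun h => F.col _ _ h F.col_eq

theorem not_kept_uv : ¬ F.Kept s(F.u, F.v) := fun h => F.not_adj_uv h.1

theorem zero_le (w : V) : f (F.pt 0 (by have := F.hN; omega)) ≤ f w := by
  have h0 : ∀ k ∈ F.K, f (F.pt 0 (by have := F.hN; omega)) ≤ f k := by
    intro k hk
    obtain ⟨i, hi, rfl⟩ := F.exists_pt hk
    exact F.pt_mono (Nat.zero_le i) hi
  by_cases hw : w ∈ F.K
  · exact h0 w hw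
  · obtain ⟨m, hm, -, -, h | h⟩ := F.low w hw
    · exact (h0 m hm).trans h
    · exact (h0 _ (F.σ_mem_K hw)).trans h

/-- A star with selected vertices on both sides of a gap has a selected leaf edge across it. -/
theorem exists_kept_of_star {l h : ℝ} {s : V}
    (hlow : ∃ m ∈ F.K, (m = s ∨ (m ∉ F.S ∧ m ≠ F.v) ∧ F.σ m = s) ∧ f m ≤ l)
    (hhigh : ∃ m ∈ F.K, (m = s ∨ (m ∉ F.S ∧ m ≠ F.v) ∧ F.σ m = s) ∧ h ≤ f m)
    (hs : f s ≤ l ∨ h ≤ f s) (hlh : l < h) :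
    ∃ e, F.Kept e ∧ Set.Ioc l h ⊆ edgeInterval f e := by
  rcases hs with hs | hs
  · obtain ⟨m, hm, rfl | ⟨⟨h1, h2⟩, rfl⟩, h3⟩ := hhigh
    · linarith
    · refine ⟨_, F.kept_star hm h1 h2, ?_⟩
      rw [Sym2.eq_swap]
      exact Ioc_subset_edgeInterval hs h3
  · obtain ⟨m, hm, rfl | ⟨⟨h1, h2⟩, rfl⟩, h3⟩ := hlow
    · linarith
    · exact ⟨_, F.kept_star hm h1 h2, Ioc_subset_edgeInterval h3 hs⟩

/-- Every gap between consecutive selected values is crossed by a kept edge, except that the last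
one may only be crossed by the edges at `v`. -/
theorem exists_crossing {j : ℕ} (hj0 : 0 < j) (hj : j < N) :
    (∃ e, F.Kept e ∧
      Set.Ioc (f (F.pt (j - 1) (by omega))) (f (F.pt j hj)) ⊆ edgeInterval f e) ∨
    f (F.pt j hj) ≤ f (F.pt (j - 1) (by omega)) ∨ (j = N - 1 ∧ F.pt j hj = F.v) := by
  set l := f (F.pt (j - 1) (by omega)) with hl
  set h := f (F.pt j hj) with hh
  rcases le_or_gt h l with hlh | hlh
  · exact Or.inr (Or.inl hlh)
  have hgap : ∀ k ∈ F.K, f k ≤ l ∨ h ≤ f k := by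
    intro k hk
    obtain ⟨i, hi, rfl⟩ := F.exists_pt hk
    rcases Nat.lt_or_ge i j with hij | hij
    · exact Or.inl (F.pt_mono (by omega) (by omega))
    · exact Or.inr (F.pt_mono hij hi)
  have htop : f F.c ≤ l → (∃ e, F.Kept e ∧ Set.Ioc l h ⊆ edgeInterval f e) ∨
      (j = N - 1 ∧ F.pt j hj = F.v) := by
    intro hc
    have key : ∀ k ∈ F.K, h ≤ f k → k ≠ F.v →
        ∃ e, F.Kept e ∧ Set.Ioc l h ⊆ edgeInterval f e := by
      intro k hk hhk hkv
      have hkS : k ∉ F.S := fun hkS => by linarith [F.c_max k hkS]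
      refine ⟨_, F.kept_star hk hkS hkv, ?_⟩
      rw [Sym2.eq_swap]
      exact Ioc_subset_edgeInterval ((F.c_max _ (F.σ_mem k hkS hkv)).trans hc) hhk
    by_cases h1 : F.pt j hj = F.v
    · rcases Nat.lt_or_ge (j + 1) N with h2 | h2
      · exact Or.inl (key (F.pt (j + 1) h2) (F.pt_mem _ _) (F.pt_mono (by omega) h2)
          fun h3 => by have := F.pt_inj (h3.trans h1.symm); omega)
      · exact Or.inr ⟨by omega, h1⟩
    · exact Or.inl (key _ (F.pt_mem _ _) le_rfl h1)
  suffices hsuff : (∃ e, F.Kept e ∧ Set.Ioc l h ⊆ edgeInterval f e) ∨ f F.c ≤ l by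
    rcases hsuff with h1 | h1
    · exact Or.inl h1
    · rcases htop h1 with h2 | h2
      · exact Or.inl h2
      · exact Or.inr (Or.inr h2)
  obtain ⟨a, b, hab, ha, hb⟩ : ∃ a b, F.H.Adj a b ∧ f a ≤ l ∧ l < f b := by
    by_contra! hcon
    have : ∀ a b, F.H.Reachable a b → f a ≤ l → f b ≤ l := by
      rintro a b ⟨p⟩
      induction p with
      | nil => exact id
      | cons hadj p ih => exact fun ha => ih (hcon _ _ hadj ha)
    have h1 := this (F.pt (j - 1) (by omega)) (F.pt j hj) (F.conn _ _) le_rfl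
    linarith
  have hleaf : ∀ w, w ∉ F.K → l < f w → F.σ w ≠ F.c →
      ∃ m ∈ F.K, (m = F.σ w ∨ (m ∉ F.S ∧ m ≠ F.v) ∧ F.σ m = F.σ w) ∧ h ≤ f m := by
    intro w hw hlw hwc
    obtain ⟨m, hm, h1, h2, h3⟩ := F.high w hw hwc
    exact ⟨m, hm, Or.inr ⟨h1, h2⟩, (hgap m hm).resolve_left (by linarith)⟩
  by_cases hbK : b ∈ F.K
  · have hhb := (hgap b hbK).resolve_left (not_le.2 hb)
    by_cases h1 : a ∉ F.K ∧ b = F.σ a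
    · obtain ⟨m, hm, h2, h3, h4⟩ := F.low a h1.1
      have h5 : f m ≤ f a := h4.resolve_right (by rw [← h1.2]; linarith)
      exact Or.inl (F.exists_kept_of_star (s := b)
        ⟨m, hm, Or.inr ⟨h2, h3.trans h1.2.symm⟩, h5.trans ha⟩ ⟨b, hbK, Or.inl rfl, hhb⟩
        (Or.inr hhb) hlh)
    · exact Or.inl ⟨_, F.kept_of_adj hab (fun h2 h3 => h1 ⟨h2, h3⟩) fun h2 => absurd hbK h2,
        Ioc_subset_edgeInterval ha hhb⟩
  · have hσK := F.σ_mem_K hbK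
    rcases le_or_gt h (f b) with hhb | hhb
    · by_cases h1 : a = F.σ b
      · by_cases h2 : F.σ b = F.c
        · exact Or.inr (by rw [← h2, ← h1]; exact ha)
        · exact Or.inl (F.exists_kept_of_star (s := F.σ b)
            ⟨_, hσK, Or.inl rfl, by rw [← h1]; exact ha⟩ (hleaf b hbK hb h2)
            (Or.inl (by rw [← h1]; exact ha)) hlh)
      · refine Or.inl ⟨_, F.kept_of_adj hab (fun h2 h3 => ?_) fun _ => h1,
          Ioc_subset_edgeInterval ha hhb⟩
        exact hbK (h3 ▸ F.σ_mem_K h2)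
    · have hlow : ∃ m ∈ F.K, (m = F.σ b ∨ (m ∉ F.S ∧ m ≠ F.v) ∧ F.σ m = F.σ b) ∧ f m ≤ l := by
        obtain ⟨m, hm, h2, h3, h4 | h4⟩ := F.low b hbK
        · exact ⟨m, hm, Or.inr ⟨h2, h3⟩, (hgap m hm).resolve_right (by linarith)⟩
        · exact ⟨_, hσK, Or.inl rfl, (hgap _ hσK).resolve_right (by linarith)⟩
      by_cases h2 : F.σ b = F.c
      · rcases hgap _ hσK with h3 | h3
        · exact Or.inr (h2 ▸ h3)
        · exact Or.inl (F.exists_kept_of_star hlow ⟨_, hσK, Or.inl rfl, h3⟩ (Or.inr h3) hlh)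
      · exact Or.inl (F.exists_kept_of_star hlow (hleaf b hbK hb h2) (hgap _ hσK) hlh)

/-- The third lowest selected value. -/
def third : ℝ := f (F.pt 2 (by have := F.hN; omega))

theorem third_le {A B k : V} (hA : A ∈ F.K) (hB : B ∈ F.K) (hAB : A ≠ B) (hk : k ∈ F.K)
    (hkA : k ≠ A) (hkB : k ≠ B) (hA2 : f A < F.third) (hB2 : f B < F.third) :
    F.third ≤ f k := by
  obtain ⟨i, hi, rfl⟩ := F.exists_pt hA
  obtain ⟨j, hj, rfl⟩ := F.exists_pt hB
  obtain ⟨l, hl, rfl⟩ := F.exists_pt hk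
  have key : ∀ i (hi : i < N), f (F.pt i hi) < F.third → i < 2 := by
    intro i hi h
    by_contra h2
    exact absurd (F.pt_mono (not_lt.1 h2) hi) (not_le.2 h)
  have h1 := key i hi hA2
  have h2 := key j hj hB2
  by_contra h3
  have h4 := key l hl (not_le.1 h3)
  have h5 : l ≠ i := fun h => hkA (by subst h; rfl)
  have h6 : l ≠ j := fun h => hkB (by subst h; rfl)
  have h7 : i ≠ j := fun h => hAB (by subst h; rfl)
  omega

theorem exists_adj (w : V) : ∃ y, F.H.Adj w y := by
  have h : F.pt 0 (by have := F.hN; omega) ≠ F.pt 1 (by have := F.hN; omega) := fun h => by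
    have := F.pt_inj h
    omega
  have : Nontrivial V := ⟨_, _, h⟩
  exact F.conn.preconnected.exists_adj_of_nontrivial w

/-- If `u` and `v` are low, then there are two selected low vertices with kept edges up to the
level of the third one. -/
theorem exists_two_low (hu : f F.u < F.third) (hv : f F.v < F.third) :
    ∃ A ∈ F.K, A ≠ F.v ∧ f A ≤ f F.u ∧ (∃ y, F.Kept s(A, y) ∧ F.third ≤ f y) ∧
      ∃ y, F.Kept s(F.v, y) ∧ F.third ≤ f y := by
  have huv : F.u ≠ F.v := F.adj.ne
  rcases F.special with ⟨huS, h1, h2⟩ | ⟨huS, hvS, h1⟩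
  · have huK := F.S_sub huS
    have hthird : ∀ k ∈ F.K, k ≠ F.u → k ≠ F.v → F.third ≤ f k := fun k hk hku hkv =>
      F.third_le huK F.v_mem huv hk hku hkv hu hv
    have hleafK : ∀ m ∈ F.K, (m ∉ F.S ∧ m ≠ F.v) → F.third ≤ f m := fun m hm h =>
      hthird m hm (fun h' => h.1 (h' ▸ huS)) h.2
    have hnl : ∀ m ∈ F.K, (m ∉ F.S ∧ m ≠ F.v) → ¬ f m < f F.u := fun m hm h h' => by
      linarith [hleafK m hm h]
    have hnl' : ∀ m ∈ F.K, (m ∉ F.S ∧ m ≠ F.v) → ¬ f m < f F.v := fun m hm h h' => by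
      linarith [hleafK m hm h]
    have hout : ∀ y, y ∉ F.K → F.σ y ≠ F.u → F.σ y ≠ F.v → F.third ≤ f y := by
      intro y hy h3 h4
      obtain ⟨m, hm, h5, -, h6 | h6⟩ := F.low y hy
      · exact (hleafK m hm h5).trans h6
      · exact (hthird _ (F.σ_mem_K hy) h3 h4).trans h6
    have hstar : ∀ s, (∃ m, (m ∉ F.S ∧ m ≠ F.v) ∧ F.σ m = s) →
        ∃ y, F.Kept s(s, y) ∧ F.third ≤ f y := by
      rintro s ⟨m, hm, rfl⟩
      by_cases hmK : m ∈ F.K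
      · exact ⟨m, by rw [Sym2.eq_swap]; exact F.kept_star hmK hm.1 hm.2, hleafK m hmK hm⟩
      · obtain ⟨m', hm', h3, h4, -⟩ := F.low m hmK
        exact ⟨m', by rw [Sym2.eq_swap, ← h4]; exact F.kept_star hm' h3.1 h3.2,
          hleafK m' hm' h3⟩
    refine ⟨F.u, huK, huv, le_rfl, ?_, ?_⟩
    · by_cases hl : ∃ m, (m ∉ F.S ∧ m ≠ F.v) ∧ F.σ m = F.u
      · exact hstar _ hl
      obtain ⟨y, hy⟩ := F.exists_adj F.u
      have hyv : y ≠ F.v := fun h => F.not_adj_uv (h ▸ hy)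
      by_cases hyK : y ∈ F.K
      · exact ⟨y, F.kept_of_adj hy (fun h => absurd huK h) fun h => absurd hyK h,
          hthird y hyK hy.ne' hyv⟩
      have hyS : y ∉ F.S := fun h => hyK (F.S_sub h)
      have hyu : F.σ y ≠ F.u := fun h => hl ⟨y, ⟨hyS, hyv⟩, h⟩
      by_cases hσv : F.σ y = F.v
      · rcases h2 y hyK hy hσv with h3 | ⟨z, hz, hzv, h3 | ⟨m, hm, h3, h4, h5⟩⟩
        · exact absurd h3 hl
        · exact ⟨z, F.kept_of_adj hz (fun h => absurd huK h) fun h => absurd h3 h,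
            hthird z h3 hz.ne' hzv⟩
        · exact absurd h5 (hnl' m hm h3)
      · exact ⟨y, F.kept_of_adj hy (fun h => absurd huK h) fun _ => hyu.symm,
          hout y hyK hyu hσv⟩
    · by_cases hl : ∃ m, (m ∉ F.S ∧ m ≠ F.v) ∧ F.σ m = F.v
      · exact hstar _ hl
      obtain ⟨y, hy⟩ := F.exists_adj F.v
      have hyu : y ≠ F.u := fun h => F.not_adj_uv (h ▸ hy).symm
      by_cases hyK : y ∈ F.K
      · exact ⟨y, F.kept_of_adj hy (fun h => absurd F.v_mem h) fun h => absurd hyK h,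
          hthird y hyK hyu hy.ne'⟩
      have hyS : y ∉ F.S := fun h => hyK (F.S_sub h)
      have hyv : F.σ y ≠ F.v := fun h => hl ⟨y, ⟨hyS, hy.ne'⟩, h⟩
      by_cases hσu : F.σ y = F.u
      · obtain ⟨z, hz, hzu, h3 | ⟨m, hm, h3, h4, h5⟩⟩ := h1 y hyK hy hσu
        · exact ⟨z, F.kept_of_adj hz (fun h => absurd F.v_mem h) fun h => absurd h3 h,
            hthird z h3 hzu hz.ne'⟩
        · exact absurd h5 (hnl m hm h3)
      · exact ⟨y, F.kept_of_adj hy (fun h => absurd F.v_mem h) fun _ => hyv.symm,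
          hout y hyK hσu hyv⟩
  · have hsS : F.σ F.u ∈ F.S := F.σ_mem _ huS huv
    have hsv : F.σ F.u ≠ F.v := fun h => hvS (h ▸ hsS)
    have hsK := F.S_sub hsS
    obtain ⟨A, hA, hAl, hAσ, hAu⟩ :
        ∃ A ∈ F.K, (A ∉ F.S ∧ A ≠ F.v) ∧ F.σ A = F.σ F.u ∧ f A ≤ f F.u := by
      by_cases huK : F.u ∈ F.K
      · exact ⟨F.u, huK, ⟨huS, huv⟩, rfl, le_rfl⟩
      obtain ⟨m', hm', h2, h3, h4⟩ := h1.resolve_left huK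
      obtain ⟨m, hm, h5, h6, h7⟩ := F.low _ huK
      refine ⟨m, hm, h5, h6, h7.resolve_right fun h8 => ?_⟩
      have := F.third_le hsK F.v_mem hsv hm' (fun h => h2.1 (h ▸ hsS)) h2.2 (by linarith) hv
      linarith
    have hthird : ∀ k ∈ F.K, k ≠ A → k ≠ F.v → F.third ≤ f k := fun k hk hkA hkv =>
      F.third_le hA F.v_mem hAl.2 hk hkA hkv (by linarith) hv
    have hpar : ∀ y, F.H.Adj F.v y → (y ∉ F.S ∧ y ≠ F.v) → F.σ y ≠ F.σ F.u := by
      intro y hy hyl hσ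
      have h2 := F.col _ _ hy
      have h3 := F.col _ _ (F.σ_adj y hyl.1 hyl.2)
      have h4 := F.col _ _ (F.σ_adj F.u huS huv)
      have h5 := F.col_eq
      rw [hσ] at h3
      revert h2 h3 h4 h5
      cases F.κ F.v <;> cases F.κ y <;> cases F.κ F.u <;> cases F.κ (F.σ F.u) <;> simp
    refine ⟨A, hA, hAl.2, hAu, ⟨F.σ F.u, ?_, ?_⟩, ?_⟩
    · rw [← hAσ]
      exact F.kept_star hA hAl.1 hAl.2
    · exact hthird _ hsK (fun h => hAl.1 (h ▸ hsS)) hsv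
    · obtain ⟨y, hy⟩ := F.exists_adj F.v
      refine ⟨y, F.kept_of_adj hy (fun h => absurd F.v_mem h) fun h h' => ?_, ?_⟩
      · exact hvS (h' ▸ F.σ_mem_S h)
      · by_cases hyK : y ∈ F.K
        · exact hthird y hyK (fun h => hpar y hy (h ▸ hAl) (h ▸ hAσ)) hy.ne'
        · have hyl : y ∉ F.S ∧ y ≠ F.v := ⟨fun h => hyK (F.S_sub h), hy.ne'⟩
          have h2 := hpar y hy hyl
          obtain ⟨m, hm, h3, h4, h5 | h5⟩ := F.low y hyK
          · refine (hthird m hm (fun h => h2 ?_) h3.2).trans h5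
            rw [← h4, h, hAσ]
          · have hσS := F.σ_mem_S hyK
            exact (hthird _ (F.S_sub hσS) (fun h => hAl.1 (h ▸ hσS))
              fun h => hvS (h ▸ hσS)).trans h5

end StarFrame

namespace StarFrame

variable {V : Type*} {G : SimpleGraph V} {f : V → ℝ} {n N : ℕ} (F : StarFrame G f n N)

theorem three_le (F : StarFrame G f n N) : 3 ≤ N := by have := F.hN; omega

/-- The interval between the values at the `j`-th vertex and its partner. -/
def piece (j : Fin n) : Set ℝ := Set.uIoc (f (F.φ j)) (f (F.φ (uPartner F.three_le F.hNn j)))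

theorem piece_zero {j : Fin n} (hj : (j : ℕ) = 0) :
    F.piece j = Set.Ioc (f (F.pt 0 (by have := F.hN; omega))) F.third := by
  have h1 : F.φ j = F.pt 0 (by have := F.hN; omega) := congrArg F.φ (Fin.ext hj)
  have h2 : F.φ (uPartner F.three_le F.hNn j) = F.pt 2 (by have := F.hN; omega) :=
    congrArg F.φ (Fin.ext (by rw [uPartner_val, if_pos hj]))
  rw [piece, h1, h2, Set.uIoc_of_le (F.pt_mono (by omega) _)]
  rfl

theorem piece_pos {j : Fin n} (hj : (j : ℕ) ≠ 0) (hjN : (j : ℕ) < N) :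
    F.piece j = Set.Ioc (f (F.pt (j - 1) (by omega))) (f (F.pt j hjN)) := by
  have h1 : F.φ j = F.pt j hjN := rfl
  have h2 : F.φ (uPartner F.three_le F.hNn j) = F.pt (j - 1) (by omega) :=
    congrArg F.φ (Fin.ext (by rw [uPartner_val, if_neg hj, if_pos hjN]))
  rw [piece, h1, h2, Set.uIoc_comm, Set.uIoc_of_le (F.pt_mono (by omega) _)]

/-- The edge `e` is `uv` or a kept edge, and the interval belonging to it covers `I`. -/
def Covers (e : Sym2 V) (I : Set ℝ) : Prop :=
  (e = s(F.u, F.v) ∧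
    I ⊆ Set.Ioc (f (F.pt 0 (by have := F.hN; omega))) (max (f F.u) (f F.v))) ∨
  (F.Kept e ∧ I ⊆ edgeInterval f e)

theorem covers_of_le {l h : ℝ} (hlh : h ≤ l) : F.Covers s(F.u, F.v) (Set.Ioc l h) :=
  Or.inl ⟨rfl, by rw [Set.Ioc_eq_empty (not_lt.2 hlh)]; exact Set.empty_subset _⟩

theorem exists_covers_head :
    f (F.pt 1 (by have := F.hN; omega)) ≤ max (f F.u) (f F.v) ∧
    ∃ e₀ e₁ e₂ : Sym2 V,
      F.Covers e₀ (Set.Ioc (f (F.pt 0 (by have := F.hN; omega))) F.third) ∧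
      F.Covers e₁ (Set.Ioc (f (F.pt 0 (by have := F.hN; omega)))
        (f (F.pt 1 (by have := F.hN; omega)))) ∧
      F.Covers e₂ (Set.Ioc (f (F.pt 1 (by have := F.hN; omega))) F.third) ∧
      (e₀ = e₁ → f (F.pt 1 (by have := F.hN; omega)) ≤ f (F.pt 0 (by have := F.hN; omega))) ∧
      (e₀ = e₂ → F.third ≤ f (F.pt 1 (by have := F.hN; omega))) := by
  have hN := F.hN
  have h01 := F.pt_mono (show 0 ≤ 1 by omega) (show 1 < N by omega)
  have h12 : f (F.pt 1 (by omega)) ≤ F.third :=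
    F.pt_mono (show 1 ≤ 2 by omega) (show 2 < N by omega)
  rcases le_or_gt F.third (max (f F.u) (f F.v)) with h | h
  · have key : ∀ j (hj0 : 0 < j) (hj2 : j ≤ 2), ∃ e,
        F.Covers e (Set.Ioc (f (F.pt (j - 1) (by omega))) (f (F.pt j (by omega)))) ∧
          (s(F.u, F.v) = e → f (F.pt j (by omega)) ≤ f (F.pt (j - 1) (by omega))) := by
      intro j hj0 hj2
      rcases F.exists_crossing hj0 (show j < N by omega) with ⟨e, he, h1⟩ | h1 | ⟨h1, -⟩
      · exact ⟨e, Or.inr ⟨he, h1⟩, fun h2 => absurd (h2 ▸ he) F.not_kept_uv⟩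
      · exact ⟨_, F.covers_of_le h1, fun _ => h1⟩
      · omega
    obtain ⟨e₁, h1, h2⟩ := key 1 (by omega) (by omega)
    obtain ⟨e₂, h3, h4⟩ := key 2 (by omega) (by omega)
    exact ⟨h12.trans h, s(F.u, F.v), e₁, e₂, Or.inl ⟨rfl, Set.Ioc_subset_Ioc_right h⟩, h1, h3,
      h2, h4⟩
  · have hu := (le_max_left _ _).trans_lt h
    have hv := (le_max_right _ _).trans_lt h
    obtain ⟨A, hA, hAv, hAu, ⟨y, hy, hy3⟩, ⟨z, hz, hz3⟩⟩ := F.exists_two_low hu hv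
    have hA3 : f A < F.third := hAu.trans_lt hu
    have hne : s(A, y) ≠ s(F.v, z) := by
      intro h'
      rcases Sym2.eq_iff.1 h' with ⟨h1, -⟩ | ⟨h1, -⟩
      · exact hAv h1
      · rw [h1] at hA3; exact absurd hz3 (not_le.2 hA3)
    have hrank : ∀ w ∈ F.K, f w < F.third → w = F.pt 0 (by omega) ∨ w = F.pt 1 (by omega) := by
      intro w hw hw3
      obtain ⟨i, hi, rfl⟩ := F.exists_pt hw
      have : i < 2 := by
        by_contra h2
        exact absurd (F.pt_mono (not_lt.1 h2) hi) (not_le.2 hw3)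
      interval_cases i
      · exact Or.inl rfl
      · exact Or.inr rfl
    have hmain : ∃ e₀ e₂, e₀ ≠ e₂ ∧ F.Kept e₀ ∧ F.Kept e₂ ∧
        Set.Ioc (f (F.pt 0 (by omega))) F.third ⊆ edgeInterval f e₀ ∧
        Set.Ioc (f (F.pt 1 (by omega))) F.third ⊆ edgeInterval f e₂ ∧
        f (F.pt 1 (by omega)) ≤ max (f F.u) (f F.v) := by
      rcases hrank A hA hA3 with h1 | h1 <;> rcases hrank F.v F.v_mem hv with h2 | h2
      · exact absurd (h1.trans h2.symm) hAv
      · exact ⟨_, _, hne, hy, hz, Ioc_subset_edgeInterval (by rw [h1]) hy3,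
          Ioc_subset_edgeInterval (by rw [h2]) hz3, by rw [← h2]; exact le_max_right _ _⟩
      · exact ⟨_, _, hne.symm, hz, hy, Ioc_subset_edgeInterval (by rw [h2]) hz3,
          Ioc_subset_edgeInterval (by rw [h1]) hy3, by
            rw [← h1]; exact hAu.trans (le_max_left _ _)⟩
      · exact absurd (h1.trans h2.symm) hAv
    obtain ⟨e₀, e₂, h1, h2, h3, h4, h5, h6⟩ := hmain
    exact ⟨h6, e₀, s(F.u, F.v), e₂, Or.inr ⟨h2, h4⟩, Or.inl ⟨rfl, Set.Ioc_subset_Ioc_right h6⟩,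
      Or.inr ⟨h3, h5⟩, fun h' => absurd (h' ▸ h2) F.not_kept_uv, fun h' => absurd h' h1⟩

/-- The edges of the extremal graph can be charged to edges of `G`: the leaf edges to the star
edges outside `K`, the others to `uv` or kept edges that cover them, disjointly for each edge. -/
theorem exists_assignment :
    ∃ α : Fin n → Sym2 V,
      (∀ j : Fin n, N ≤ j → α j = s(F.φ j, F.σ (F.φ j))) ∧
      (∀ j : Fin n, (j : ℕ) < N → F.Covers (α j) (F.piece j)) ∧
      (∀ i j : Fin n, i ≠ j → (i : ℕ) < N → (j : ℕ) < N → α i = α j →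
        Disjoint (F.piece i) (F.piece j)) := by
  have hN := F.hN
  obtain ⟨-, e₀, e₁, e₂, h0, h1, h2, h01, h02⟩ := F.exists_covers_head
  have key : ∀ j : Fin n, ∃ e : Sym2 V, (N ≤ j → e = s(F.φ j, F.σ (F.φ j))) ∧
      ((j : ℕ) < N → F.Covers e (F.piece j)) ∧ ((j : ℕ) = 0 → e = e₀) ∧
      ((j : ℕ) = 1 → e = e₁) ∧ ((j : ℕ) = 2 → e = e₂) := by
    intro j
    rcases Nat.lt_or_ge j N with hj | hj
    · rcases Nat.lt_or_ge j 3 with hj3 | hj3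
      · have h : (j : ℕ) = 0 ∨ (j : ℕ) = 1 ∨ (j : ℕ) = 2 := by omega
        rcases h with h | h | h
        · exact ⟨e₀, by omega, fun _ => by rw [F.piece_zero h]; exact h0, fun _ => rfl,
            by omega, by omega⟩
        · refine ⟨e₁, by omega, fun _ => ?_, by omega, fun _ => rfl, by omega⟩
          rw [F.piece_pos (by omega) hj]
          simpa only [h] using h1
        · refine ⟨e₂, by omega, fun _ => ?_, by omega, by omega, fun _ => rfl⟩
          rw [F.piece_pos (by omega) hj]
          simpa only [h, third] using h2
      · rcases F.exists_crossing (show 0 < (j : ℕ) by omega) hj with ⟨e, he, h⟩ | h | ⟨-, h⟩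
        · exact ⟨e, by omega, fun _ => by
            rw [F.piece_pos (by omega) hj]; exact Or.inr ⟨he, h⟩, by omega, by omega, by omega⟩
        · exact ⟨s(F.u, F.v), by omega, fun _ => by
            rw [F.piece_pos (by omega) hj]; exact F.covers_of_le h, by omega, by omega, by omega⟩
        · refine ⟨s(F.u, F.v), by omega, fun _ => ?_, by omega, by omega, by omega⟩
          rw [F.piece_pos (by omega) hj]
          exact Or.inl ⟨rfl, Set.Ioc_subset_Ioc (F.zero_le _) (h ▸ le_max_right _ _)⟩
    · exact ⟨_, fun _ => rfl, by omega, by omega, by omega, by omega⟩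
  choose α hα1 hα2 hα3 hα4 hα5 using key
  refine ⟨α, hα1, hα2, ?_⟩
  have hlt : ∀ i j : Fin n, (i : ℕ) < j → (j : ℕ) < N → α i = α j →
      Disjoint (F.piece i) (F.piece j) := by
    intro i j hij hj hαij
    have hpj := F.piece_pos (show (j : ℕ) ≠ 0 by omega) hj
    by_cases hi : (i : ℕ) = 0
    · rcases Nat.lt_or_ge j 3 with hj3 | hj3
      · have h : (j : ℕ) = 1 ∨ (j : ℕ) = 2 := by omega
        have hempty : F.piece j = ∅ := by
          rw [hpj]
          apply Set.Ioc_eq_empty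
          rw [not_lt]
          rcases h with h | h
          · simpa only [h] using h01 (by rw [← hα3 i hi, ← hα4 j h, hαij])
          · simpa only [h, third] using h02 (by rw [← hα3 i hi, ← hα5 j h, hαij])
        rw [hempty]
        exact Set.disjoint_empty _
      · rw [F.piece_zero hi, hpj, Set.Ioc_disjoint_Ioc]
        exact (min_le_left _ _).trans ((F.pt_mono (show 2 ≤ (j : ℕ) - 1 by omega)
          (by omega)).trans (le_max_right _ _))
    · rw [F.piece_pos hi (by omega), hpj, Set.Ioc_disjoint_Ioc]
      exact (min_le_left _ _).trans ((F.pt_mono (show (i : ℕ) ≤ (j : ℕ) - 1 by omega)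
        (by omega)).trans (le_max_right _ _))
  intro i j hij hi hj hαij
  rcases Nat.lt_or_ge (i : ℕ) j with h | h
  · exact hlt i j h hj hαij
  · exact (hlt j i (lt_of_le_of_ne h fun h' => hij (Fin.ext h'.symm)) hi hαij.symm).symm

end StarFrame

theorem sum_abs_sub_le {ι : Type*} (J : Finset ι) (x y : ι → ℝ) {a b : ℝ} (hab : a ≤ b)
    (hdisj : ∀ i ∈ J, ∀ j ∈ J, i ≠ j → Disjoint (Set.uIoc (x i) (y i)) (Set.uIoc (x j) (y j)))
    (hsub : ∀ i ∈ J, Set.uIoc (x i) (y i) ⊆ Set.Ioc a b) : ∑ i ∈ J, |y i - x i| ≤ b - a := by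
  have h1 : MeasureTheory.volume (⋃ i ∈ J, Set.uIoc (x i) (y i)) =
      ∑ i ∈ J, ENNReal.ofReal |y i - x i| := by
    rw [MeasureTheory.measure_biUnion_finset (fun i hi j hj hij => hdisj i hi j hj hij)
      fun i _ => measurableSet_uIoc]
    exact Finset.sum_congr rfl fun i _ => Real.volume_uIoc
  have h2 := MeasureTheory.measure_mono (μ := MeasureTheory.volume) (Set.iUnion₂_subset hsub)
  rw [h1, Real.volume_Ioc, ← ENNReal.ofReal_sum_of_nonneg fun i _ => abs_nonneg _,
    ENNReal.ofReal_le_ofReal_iff (sub_nonneg.2 hab)] at h2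
  exact h2

/-- The squares of the lengths of disjoint subintervals add up to at most the square of the whole
length, with equality only if one of them is the whole interval. -/
theorem sum_sq_sub_le {ι : Type*} (J : Finset ι) (x y : ι → ℝ) {a b : ℝ} (hab : a ≤ b)
    (hdisj : ∀ i ∈ J, ∀ j ∈ J, i ≠ j → Disjoint (Set.uIoc (x i) (y i)) (Set.uIoc (x j) (y j)))
    (hsub : ∀ i ∈ J, Set.uIoc (x i) (y i) ⊆ Set.Ioc a b) :
    ∑ i ∈ J, (y i - x i) ^ 2 ≤ (b - a) ^ 2 ∧
      (∑ i ∈ J, (y i - x i) ^ 2 = (b - a) ^ 2 → a < b →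
        ∃ i ∈ J, Set.uIoc (x i) (y i) = Set.Ioc a b) := by
  have h1 := sum_abs_sub_le J x y hab hdisj hsub
  have h2 : ∀ i ∈ J, |y i - x i| ≤ b - a := fun i hi =>
    (Finset.single_le_sum (f := fun i => |y i - x i|) (fun i _ => abs_nonneg _) hi).trans h1
  have h3 : ∀ i ∈ J, (y i - x i) ^ 2 ≤ |y i - x i| * (b - a) := fun i hi => by
    rw [← sq_abs, sq]
    exact mul_le_mul_of_nonneg_left (h2 i hi) (abs_nonneg _)
  have h4 : ∑ i ∈ J, |y i - x i| * (b - a) ≤ (b - a) ^ 2 := by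
    rw [← Finset.sum_mul, sq]
    exact mul_le_mul_of_nonneg_right h1 (sub_nonneg.2 hab)
  refine ⟨(Finset.sum_le_sum h3).trans h4, fun heq hlt => ?_⟩
  have h5 : ∑ i ∈ J, (y i - x i) ^ 2 = ∑ i ∈ J, |y i - x i| * (b - a) :=
    le_antisymm (Finset.sum_le_sum h3) (h4.trans_eq heq.symm)
  have h6 := (Finset.sum_eq_sum_iff_of_le h3).1 h5
  have h7 : ∃ i ∈ J, (y i - x i) ^ 2 ≠ 0 := by
    by_contra! h
    rw [Finset.sum_eq_zero h] at heq
    have : 0 < (b - a) ^ 2 := by have := sub_pos.2 hlt; positivity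
    linarith
  obtain ⟨i, hi, hne⟩ := h7
  have hpos : 0 < |y i - x i| := abs_pos.2 fun h => hne (by rw [h]; norm_num)
  have h8 : |y i - x i| = b - a := by
    have := h6 i hi
    rw [← sq_abs, sq] at this
    exact mul_left_cancel₀ hpos.ne' this
  refine ⟨i, hi, ?_⟩
  have h9 := hsub i hi
  rw [Set.uIoc] at h9 ⊢
  have h10 : max (x i) (y i) - min (x i) (y i) = |y i - x i| := by
    rw [max_sub_min_eq_abs]
  have h11 : min (x i) (y i) < max (x i) (y i) := by linarith
  rw [Set.Ioc_subset_Ioc_iff h11] at h9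
  congr 1 <;> linarith [h9.1, h9.2]

theorem sq_abs_sub_abs_le (a b : ℝ) : (|a| - |b|) ^ 2 ≤ (a + b) ^ 2 := by
  have := neg_abs_le (a * b)
  rw [abs_mul] at this
  nlinarith [sq_abs a, sq_abs b]

namespace StarFrame

variable {V : Type*} {G : SimpleGraph V} {f : V → ℝ} {n N : ℕ} (F : StarFrame G f n N)

/-- The difference of `f` at the ends of the `j`-th edge of the extremal graph. -/
noncomputable def gap (j : Fin n) : ℝ :=
  if (j : ℕ) < N then f (F.φ (uPartner F.three_le F.hNn j)) - f (F.φ j)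
  else f (F.φ j) - f (F.σ (F.φ j))

/-- The test vector on the extremal graph. -/
noncomputable def test (j : Fin n) : ℝ :=
  if (j : ℕ) < N then f (F.φ j)
  else f (F.pt (N - 1) (by have := F.hN; omega)) + |f (F.φ j) - f (F.σ (F.φ j))|

theorem le_test (j : Fin n) : f (F.φ j) ≤ F.test j := by
  unfold test
  split_ifs with h
  · exact le_rfl
  · have hj : F.φ j ∉ F.K := fun h' => h ((F.mem_iff j).1 h')
    obtain ⟨i, hi, h1⟩ := F.exists_pt (F.σ_mem_K hj)
    have h2 := F.pt_mono (show i ≤ N - 1 by omega) (by omega)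
    rw [h1] at h2
    linarith [le_abs_self (f (F.φ j) - f (F.σ (F.φ j)))]

theorem uForm_test : uForm F.three_le F.hNn F.test =
    4 * f (F.pt 0 (by have := F.hN; omega)) * f (F.pt 1 (by have := F.hN; omega)) +
      ∑ j, F.gap j ^ 2 := by
  have hN := F.hN
  have hNn := F.hNn
  have key : ∀ j, uLin F.three_le F.hNn j F.test ^ 2 =
      (if j = (⟨1, by omega⟩ : Fin n) then
        4 * f (F.pt 0 (by omega)) * f (F.pt 1 (by omega)) else 0) + F.gap j ^ 2 := by
    intro j
    simp only [Fin.ext_iff]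
    rcases Nat.lt_or_ge j N with hj | hj
    · have hp : (uPartner F.three_le F.hNn j : ℕ) < N := by
        rw [uPartner_val]; split_ifs <;> omega
      simp only [uLin, test, gap, hj, hp, if_true]
      split_ifs with h1
      · have h2 : F.φ j = F.pt 1 (by omega) := congrArg F.φ (Fin.ext h1)
        have h3 : F.φ (uPartner F.three_le F.hNn j) = F.pt 0 (by omega) :=
          congrArg F.φ (Fin.ext (by rw [uPartner_val]; simp [h1]; omega))
        rw [h2, h3]
        ring
      · ring
    · have hp : (uPartner F.three_le F.hNn j : ℕ) = N - 1 := by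
        rw [uPartner_val]; split_ifs <;> omega
      have h3 : F.φ (uPartner F.three_le F.hNn j) = F.pt (N - 1) (by omega) :=
        congrArg F.φ (Fin.ext hp)
      simp only [uLin, test, gap, not_lt.2 hj, hp, if_false, show N - 1 < N by omega, if_true, h3,
        show ¬ (j : ℕ) = 1 by omega, add_sub_cancel_left, sq_abs, zero_add]
  simp only [uForm, key, Finset.sum_add_distrib]
  simp

/-- How much of the form of the extremal graph is charged to an edge of `G`. -/
noncomputable def load [DecidableEq V] (α : Fin n → Sym2 V) (e : Sym2 V) : ℝ :=
  (if e = s(F.u, F.v) then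
    4 * f (F.pt 0 (by have := F.hN; omega)) * f (F.pt 1 (by have := F.hN; omega)) else 0) +
  ∑ j with α j = e, F.gap j ^ 2

/-- The properties of the assignment of `exists_assignment`. -/
def IsAssignment (α : Fin n → Sym2 V) : Prop :=
  (∀ j : Fin n, N ≤ j → α j = s(F.φ j, F.σ (F.φ j))) ∧
  (∀ j : Fin n, (j : ℕ) < N → F.Covers (α j) (F.piece j)) ∧
  (∀ i j : Fin n, i ≠ j → (i : ℕ) < N → (j : ℕ) < N → α i = α j →
    Disjoint (F.piece i) (F.piece j))

variable {F} {α : Fin n → Sym2 V}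

theorem notMem_K_of_le {j : Fin n} (hj : N ≤ j) : F.φ j ∉ F.K := fun h =>
  absurd ((F.mem_iff j).1 h) (not_lt.2 hj)

theorem IsAssignment.mem_edgeSet (hα : F.IsAssignment α) (j : Fin n) : α j ∈ G.edgeSet := by
  rcases Nat.lt_or_ge j N with hj | hj
  · rcases hα.2.1 j hj with ⟨h, -⟩ | ⟨h, -⟩
    · rw [h]; exact F.adj
    · exact edgeSet_mono F.le h.1
  · rw [hα.1 j hj]
    exact F.le (F.σ_adj' (notMem_K_of_le hj))

theorem load_uv [DecidableEq V] (hα : F.IsAssignment α) (h0 : ∀ w, 0 ≤ f w) :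
    F.load α s(F.u, F.v) ≤ (f F.u + f F.v) ^ 2 ∧
      (F.load α s(F.u, F.v) = (f F.u + f F.v) ^ 2 →
        f (F.pt 1 (by have := F.hN; omega)) = f (F.pt 0 (by have := F.hN; omega)) →
        0 < f (F.pt 0 (by have := F.hN; omega)) →
        max (f F.u) (f F.v) ≤ f (F.pt 0 (by have := F.hN; omega))) := by
  have hN := F.hN
  have hlt : ∀ j, α j = s(F.u, F.v) → (j : ℕ) < N := by
    intro j hj
    by_contra h
    rw [hα.1 j (not_lt.1 h)] at hj
    have := F.σ_adj' (notMem_K_of_le (not_lt.1 h))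
    rw [← SimpleGraph.mem_edgeSet, hj] at this
    exact F.not_adj_uv this
  have hp0 := F.zero_le F.u
  have hp1 := F.exists_covers_head.1
  set M := max (f F.u) (f F.v) with hM
  set p₀ := f (F.pt 0 (by omega))
  set p₁ := f (F.pt 1 (by omega))
  have hsum := (sum_sq_sub_le (Finset.univ.filter fun j => α j = s(F.u, F.v))
    (fun j => f (F.φ j)) (fun j => f (F.φ (uPartner F.three_le F.hNn j)))
    (a := p₀) (b := M) (hp0.trans (le_max_left _ _))
    (fun i hi j hj hij => hα.2.2 i j hij (hlt i (by simpa using hi)) (hlt j (by simpa using hj))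
      (by simp at hi hj; rw [hi, hj]))
    (fun j hj => by
      have hj' : α j = s(F.u, F.v) := by simpa using hj
      rcases hα.2.1 j (hlt j hj') with ⟨-, h⟩ | ⟨h, -⟩
      · exact h
      · exact absurd (hj' ▸ h) F.not_kept_uv)).1
  have hload : F.load α s(F.u, F.v) ≤ 4 * p₀ * p₁ + (M - p₀) ^ 2 := by
    rw [load, if_pos rfl]
    refine add_le_add le_rfl (le_trans (le_of_eq ?_) hsum)
    refine Finset.sum_congr rfl fun j hj => ?_
    rw [gap, if_pos (hlt j (by simpa using hj))]
  have h2 : p₀ + M ≤ f F.u + f F.v := by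
    have hv := F.zero_le F.v
    rcases max_cases (f F.u) (f F.v) with ⟨h, -⟩ | ⟨h, -⟩ <;> rw [hM, h] <;> linarith
  have h3 : 0 ≤ p₀ := h0 _
  have h4 : (p₀ + M) ^ 2 ≤ (f F.u + f F.v) ^ 2 :=
    pow_le_pow_left₀ (by linarith [h0 F.u, le_max_left (f F.u) (f F.v)]) h2 2
  have h5 : p₀ * p₁ ≤ p₀ * M := mul_le_mul_of_nonneg_left hp1 h3
  refine ⟨by nlinarith, fun heq h10 hpos => ?_⟩
  rw [h10] at hload
  have h6 : p₀ * M ≤ p₀ * p₀ := by nlinarith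
  exact le_of_mul_le_mul_left h6 hpos

theorem load_kept [DecidableEq V] (hα : F.IsAssignment α) {i j : V} (hij : F.Kept s(i, j)) :
    F.load α s(i, j) ≤ (f i - f j) ^ 2 ∧
      (F.load α s(i, j) = (f i - f j) ^ 2 → f i ≠ f j →
        ∃ k : Fin n, (k : ℕ) < N ∧ F.piece k = Set.uIoc (f i) (f j)) := by
  have hne : s(i, j) ≠ s(F.u, F.v) := fun h => F.not_kept_uv (h ▸ hij)
  have hlt : ∀ k, α k = s(i, j) → (k : ℕ) < N := by
    intro k hk
    by_contra h
    rw [hα.1 k (not_lt.1 h)] at hk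
    exact hij.2 _ (notMem_K_of_le (not_lt.1 h)) hk.symm
  obtain ⟨h1, h2⟩ := sum_sq_sub_le (Finset.univ.filter fun k => α k = s(i, j))
    (fun k => f (F.φ k)) (fun k => f (F.φ (uPartner F.three_le F.hNn k)))
    (a := min (f i) (f j)) (b := max (f i) (f j)) min_le_max
    (fun i hi j hj hij => hα.2.2 i j hij (hlt i (by simpa using hi)) (hlt j (by simpa using hj))
      (by simp at hi hj; rw [hi, hj]))
    (fun k hk => by
      have hk' : α k = s(i, j) := by simpa using hk
      rcases hα.2.1 k (hlt k hk') with ⟨h, -⟩ | ⟨-, h⟩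
      · exact absurd (hk'.symm.trans h) hne
      · rw [hk'] at h; exact h)
  have hload : F.load α s(i, j) = ∑ k with α k = s(i, j),
      (f (F.φ (uPartner F.three_le F.hNn k)) - f (F.φ k)) ^ 2 := by
    rw [load, if_neg hne, zero_add]
    refine Finset.sum_congr rfl fun k hk => ?_
    rw [gap, if_pos (hlt k (by simpa using hk))]
  have hsq : (max (f i) (f j) - min (f i) (f j)) ^ 2 = (f i - f j) ^ 2 := by
    rw [max_sub_min_eq_abs, sq_abs]; ring
  rw [hsq] at h1 h2
  rw [hload]
  refine ⟨h1, fun h3 h4 => ?_⟩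
  obtain ⟨k, hk, h5⟩ := h2 h3 (min_lt_max.2 h4)
  exact ⟨k, hlt k (by simpa using hk), h5⟩

theorem load_star [DecidableEq V] (hα : F.IsAssignment α) {w : V} (hw : w ∉ F.K) :
    F.load α s(w, F.σ w) = (f w - f (F.σ w)) ^ 2 := by
  have hne : s(w, F.σ w) ≠ s(F.u, F.v) := by
    intro h
    have := F.σ_adj' hw
    rw [← SimpleGraph.mem_edgeSet, h] at this
    exact F.not_adj_uv this
  have hwN : ¬ ((F.φ.symm w : Fin n) : ℕ) < N := fun h => hw (by
    simpa using (F.mem_iff (F.φ.symm w)).2 h)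
  have hfib : (Finset.univ.filter fun j => α j = s(w, F.σ w)) = {F.φ.symm w} := by
    ext j
    simp only [Finset.mem_filter, Finset.mem_univ, true_and, Finset.mem_singleton]
    constructor
    · intro hj
      rcases Nat.lt_or_ge j N with h | h
      · rcases hα.2.1 j h with ⟨h1, -⟩ | ⟨h1, -⟩
        · exact absurd (hj.symm.trans h1) hne
        · exact absurd hj (h1.2 w hw)
      · rw [hα.1 j h] at hj
        rcases Sym2.eq_iff.1 hj with ⟨h1, -⟩ | ⟨h1, -⟩
        · rw [← h1]; simp
        · exact absurd (h1 ▸ F.σ_mem_K hw) (notMem_K_of_le h)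
    · rintro rfl
      rw [hα.1 _ (not_lt.1 hwN)]
      simp
  rw [load, if_neg hne, hfib, Finset.sum_singleton, gap, if_neg hwN]
  simp

theorem load_other [DecidableEq V] (hα : F.IsAssignment α) {e : Sym2 V} (he : e ≠ s(F.u, F.v))
    (hk : ¬ F.Kept e) (hs : ∀ w, w ∉ F.K → e ≠ s(w, F.σ w)) : F.load α e = 0 := by
  have hfib : (Finset.univ.filter fun j => α j = e) = ∅ := by
    rw [Finset.filter_eq_empty_iff]
    rintro j - rfl
    rcases Nat.lt_or_ge j N with h | h
    · rcases hα.2.1 j h with ⟨h1, -⟩ | ⟨h1, -⟩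
      · exact he h1
      · exact hk h1
    · exact hs _ (notMem_K_of_le h) (hα.1 j h)
  rw [load, if_neg he, hfib]
  simp

end StarFrame

theorem card_le_card_edgeSet {V : Type*} [Finite V] {G : SimpleGraph V} (hconn : G.Connected)
    (hbip : ¬ G.IsBipartite) : Nat.card V ≤ Nat.card G.edgeSet := by
  have h1 := hconn.card_vert_le_card_edgeSet_add_one
  by_contra h2
  exact hbip (isTree_iff_connected_and_card.2 ⟨hconn, by omega⟩).isBipartite

/-- A connected non-bipartite spanning subgraph of `uGraph n (n - N) 3` is the whole graph. -/
theorem nonempty_iso_uGraph {V : Type*} [Finite V] {G : SimpleGraph V} (hconn : G.Connected)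
    (hbip : ¬ G.IsBipartite) {n N : ℕ} (hN : 3 ≤ N) (hNn : N ≤ n) (φ : Fin n ≃ V)
    (h : ∀ i j, G.Adj (φ i) (φ j) → (uGraph n (n - N) 3).Adj i j) :
    Nonempty (G ≃g uGraph n (n - N) 3) := by
  have e : G.comap φ ≃g G := Iso.comap φ G
  have hle : G.comap φ ≤ uGraph n (n - N) 3 := fun i j hij => h i j hij
  have hc : (G.comap φ).Connected := e.connected_iff.2 hconn
  have hb : ¬ (G.comap φ).IsBipartite := by
    intro h1
    obtain ⟨κ, hκ⟩ := exists_bool_coloring_of_isBipartite h1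
    refine hbip (isBipartite_of_bool_coloring (fun w => κ (e.symm w)) fun i j hij => ?_)
    exact hκ _ _ (e.symm.map_adj_iff.2 hij)
  have h1 := card_le_card_edgeSet hc hb
  rw [Nat.card_fin] at h1
  have h2 := card_edgeSet_uGraph_le hN hNn
  have h3 : (G.comap φ).edgeSet = (uGraph n (n - N) 3).edgeSet :=
    Set.eq_of_subset_of_ncard_le (edgeSet_mono hle)
      (by rw [← Nat.card_coe_set_eq, ← Nat.card_coe_set_eq]; exact h2.trans h1) (Set.toFinite _)
  rw [edgeSet_inj] at h3
  exact ⟨h3 ▸ e.symm⟩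

namespace StarFrame

variable {V : Type*} [Fintype V] {G : SimpleGraph V} {x : V → ℝ} {n N : ℕ}
  {F : StarFrame G (fun w => |x w|) n N} {α : Fin n → Sym2 V}

theorem load_le [DecidableEq V] (hα : F.IsAssignment α) (hx : 0 ≤ x F.u * x F.v) (e : Sym2 V) :
    F.load α e ≤ edgeEnergy x e := by
  by_cases he : e = s(F.u, F.v)
  · subst he
    refine (load_uv hα fun w => abs_nonneg _).1.trans (le_of_eq ?_)
    rw [edgeEnergy_mk, add_sq, add_sq, sq_abs, sq_abs, mul_assoc, ← abs_mul, abs_of_nonneg hx,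
      mul_assoc]
  by_cases hk : F.Kept e
  · induction e with | _ i j =>
    exact (load_kept hα hk).1.trans (sq_abs_sub_abs_le _ _)
  by_cases hs : ∃ w, w ∉ F.K ∧ e = s(w, F.σ w)
  · obtain ⟨w, hw, rfl⟩ := hs
    rw [load_star hα hw]
    exact sq_abs_sub_abs_le _ _
  · push Not at hs
    rw [load_other hα he hk hs]
    exact edgeEnergy_nonneg x e

open Classical in
theorem sum_load (hα : F.IsAssignment α) :
    ∑ e : Sym2 V with e ∈ G.edgeSet, F.load α e = uForm F.three_le F.hNn F.test := by
  rw [uForm_test]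
  simp only [load, Finset.sum_add_distrib]
  congr 1
  · rw [Finset.sum_ite_eq', if_pos]
    simpa using F.adj
  · exact Finset.sum_fiberwise_of_maps_to (fun j _ => by simpa using hα.mem_edgeSet j) _

theorem sum_sq_eq : ∑ w, x w ^ 2 = ∑ j, |x (F.φ j)| ^ 2 := by
  simp only [sq_abs]
  exact (F.φ.sum_comp fun w => x w ^ 2).symm

theorem sum_sq_le : ∑ w, x w ^ 2 ≤ ∑ j, F.test j ^ 2 := by
  rw [sum_sq_eq (F := F)]
  exact Finset.sum_le_sum fun j _ => pow_le_pow_left₀ (abs_nonneg _) (F.le_test j) 2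

theorem sum_sq_pos (hx0 : x ≠ 0) : 0 < ∑ w, x w ^ 2 := by
  obtain ⟨i, hi⟩ := Function.ne_iff.1 hx0
  exact Finset.sum_pos' (fun i _ => sq_nonneg _) ⟨i, Finset.mem_univ i, by
    have : x i ≠ 0 := hi
    positivity⟩

theorem uForm_test_le (hα : F.IsAssignment α) (hx : 0 ≤ x F.u * x F.v) :
    uForm F.three_le F.hNn F.test ≤ G.energy x := by
  classical
  rw [← sum_load hα, energy]
  exact Finset.sum_le_sum fun e _ => load_le hα hx e

theorem qMin_le (hx : 0 ≤ x F.u * x F.v) (hx0 : x ≠ 0)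
    (hE : G.energy x = G.qMin * ∑ w, x w ^ 2) (hq : 0 < G.qMin) :
    (uGraph n (n - N) 3).qMin ≤ G.qMin := by
  obtain ⟨α, hα⟩ := F.exists_assignment
  have h1 := qMin_uGraph_le F.three_le F.hNn F.test
  have h2 := uForm_test_le hα hx
  have h3 := sum_sq_le (F := F)
  have h4 := (sum_sq_pos hx0).trans_le h3
  have h5 := mul_le_mul_of_nonneg_left h3 hq.le
  exact le_of_mul_le_mul_right (by linarith) h4

theorem nonempty_iso (hconn : G.Connected) (hbip : ¬ G.IsBipartite) (hx : 0 ≤ x F.u * x F.v)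
    (hx0 : x ≠ 0) (hE : G.energy x = G.qMin * ∑ w, x w ^ 2) (hq : 0 < G.qMin)
    (heq : G.qMin = (uGraph n (n - N) 3).qMin) : Nonempty (G ≃g uGraph n (n - N) 3) := by
  classical
  obtain ⟨α, hα⟩ := F.exists_assignment
  have hN := F.hN
  have hNn := F.hNn
  have hn : 4 ≤ n := hN.trans hNn
  have h1 := qMin_uGraph_le F.three_le F.hNn F.test
  have h2 := uForm_test_le hα hx
  have h3 := sum_sq_le (F := F)
  have h4 := (sum_sq_pos hx0).trans_le h3
  have h5 := mul_le_mul_of_nonneg_left h3 hq.le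
  have ha : uForm F.three_le F.hNn F.test =
      (uGraph n (n - N) 3).qMin * ∑ j, F.test j ^ 2 := by
    rw [← heq] at h1 ⊢; linarith
  have hsum : ∑ w, x w ^ 2 = ∑ j, F.test j ^ 2 := by
    refine mul_left_cancel₀ hq.ne' (le_antisymm h5 ?_)
    rw [← heq] at h1; linarith
  have htest : ∀ j, |x (F.φ j)| = F.test j := by
    intro j
    rw [sum_sq_eq (F := F)] at hsum
    have := (Finset.sum_eq_sum_iff_of_le fun j _ =>
      pow_le_pow_left₀ (abs_nonneg (x (F.φ j))) (F.le_test j) 2).1 hsum j (Finset.mem_univ j)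
    exact (pow_left_inj₀ (abs_nonneg _) ((abs_nonneg _).trans (F.le_test j)) two_ne_zero).1 this
  have hload : ∀ e ∈ G.edgeSet, F.load α e = edgeEnergy x e := by
    have h6 : ∑ e : Sym2 V with e ∈ G.edgeSet, F.load α e =
        ∑ e : Sym2 V with e ∈ G.edgeSet, edgeEnergy x e := by
      rw [sum_load hα]
      refine le_antisymm h2 ?_
      change G.energy x ≤ _
      rw [ha, hE, hsum, heq]
    intro e he
    exact (Finset.sum_eq_sum_iff_of_le fun e _ => load_le hα hx e).1 h6 e (by simpa using he)
  rw [heq] at hq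
  set q := (uGraph n (n - N) 3).qMin with hqdef
  set a := F.test with hadef
  have hnn : ∀ j, 0 ≤ a j := fun j => by rw [← htest]; exact abs_nonneg _
  have ha0 : a ≠ 0 := by
    intro h
    rw [h] at h4
    simp at h4
  have h00 : 0 < a ⟨0, by omega⟩ :=
    lt_of_le_of_ne (hnn _) (stationary_zero_ne_zero F.three_le hNn ha hn ha0 hq (Or.inl hnn)).symm
  have h01 : a ⟨0, by omega⟩ = a ⟨1, by omega⟩ := stationary_zero_eq_one F.three_le hNn ha hn
  have hpt : ∀ i (hi : i < N), |x (F.pt i hi)| = a ⟨i, hi.trans_le hNn⟩ := fun i hi => htest _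
  have hpos : ∀ j, 0 < a j := fun j => h00.trans_le (by
    rw [← hpt 0 (by omega), ← htest j]
    exact F.zero_le _)
  have hsumpos : ∀ k : Fin n, 0 < ∑ l ∈ Finset.univ.filter (fun l : Fin n => (k : ℕ) ≤ l), a l :=
    fun k => Finset.sum_pos (fun l _ => hpos l) ⟨k, by simp⟩
  have h12 : a ⟨1, by omega⟩ < a ⟨2, by omega⟩ := by
    have h6 := stationary_two_flux F.three_le hNn ha
    have h7 := mul_pos hq (hsumpos ⟨2, by omega⟩)
    simp only at h7
    linarith
  have hstep : ∀ j (hj : j < N) (hj2 : 2 ≤ j), a ⟨j - 1, by omega⟩ < a ⟨j, by omega⟩ := by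
    intro j hj hj2
    rcases hj2.eq_or_lt with rfl | hj3
    · exact h12
    · have h6 := stationary_flux F.three_le hNn ha (j := ⟨j, by omega⟩) hj3 hj
      have h7 := mul_pos hq (hsumpos ⟨j, by omega⟩)
      simp only at h6 h7
      linarith
  have hmono : ∀ j (hj : j < N) i (hij : i < j) (hi : 1 ≤ i),
      a ⟨i, by omega⟩ < a ⟨j, by omega⟩ := by
    intro j
    induction j with
    | zero => intro hj i hij; omega
    | succ j ih =>
      intro hj i hij hi
      have h6 := hstep (j + 1) hj (by omega)
      simp only [Nat.add_sub_cancel] at h6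
      rcases (Nat.lt_succ_iff.1 hij).eq_or_lt with rfl | h7
      · exact h6
      · exact (ih (by omega) i h7 hi).trans h6
  have hleaf : ∀ j : Fin n, N ≤ j → ∀ i (hi : i < N), a ⟨i, by omega⟩ < a j := by
    intro j hj i hi
    have h6 := stationary_leaf F.three_le hNn ha hj
    have h7 := mul_pos hq (hpos j)
    have h8 := F.pt_mono (show i ≤ N - 1 by omega) (by omega)
    simp only [hpt] at h8
    linarith
  have hinj : ∀ i j : Fin n, a i = a j →
      i = j ∨ ((i : ℕ) ≤ 1 ∧ (j : ℕ) ≤ 1) ∨ (N ≤ i ∧ N ≤ j) := by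
    have key : ∀ i j : Fin n, i < j → a i = a j →
        ((i : ℕ) ≤ 1 ∧ (j : ℕ) ≤ 1) ∨ (N ≤ i ∧ N ≤ j) := by
      intro i j hij h
      have hij' : (i : ℕ) < j := hij
      rcases Nat.lt_or_ge j N with hj | hj
      · rcases Nat.lt_or_ge j 2 with h6 | h6
        · left; omega
        · exfalso
          rcases Nat.eq_zero_or_pos i with h7 | h7
          · have h8 := hmono j hj 1 (by omega) le_rfl
            rw [← h01, ← show i = ⟨0, by omega⟩ from Fin.ext h7] at h8
            exact h8.ne h
          · exact (hmono j hj i hij' h7).ne h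
      · rcases Nat.lt_or_ge i N with hi | hi
        · exact absurd h (hleaf j hj i hi).ne
        · exact Or.inr ⟨hi, hj⟩
    intro i j h
    rcases lt_trichotomy i j with h6 | h6 | h6
    · exact Or.inr (key i j h6 h)
    · exact Or.inl h6
    · rcases key j i h6 h.symm with h7 | h7
      · exact Or.inr (Or.inl h7.symm)
      · exact Or.inr (Or.inr h7.symm)
  have huv : ∀ i j : Fin n, s(F.φ i, F.φ j) = s(F.u, F.v) ↔
      i ≠ j ∧ (i : ℕ) ≤ 1 ∧ (j : ℕ) ≤ 1 := by
    have h6 := (load_uv hα fun w => abs_nonneg _).2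
    have h7 : (|x F.u| + |x F.v|) ^ 2 = edgeEnergy x s(F.u, F.v) := by
      rw [edgeEnergy_mk, add_sq, add_sq, sq_abs, sq_abs, mul_assoc, ← abs_mul, abs_of_nonneg hx,
        mul_assoc]
    simp only [h7, hpt] at h6
    have h8 := h6 (hload _ F.adj) h01.symm h00
    have h9 : ∀ w, |x w| ≤ a ⟨0, by omega⟩ → ((F.φ.symm w : Fin n) : ℕ) ≤ 1 := by
      intro w hw
      have h10 : a (F.φ.symm w) = a ⟨0, by omega⟩ := by
        refine le_antisymm (by rw [← htest]; simpa using hw) ?_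
        rw [← hpt 0 (by omega), ← htest]
        exact F.zero_le _
      rcases hinj _ _ h10 with h11 | h11 | h11
      · rw [h11]; simp
      · exact h11.1
      · simp only at h11; omega
    have hu := h9 F.u ((le_max_left _ _).trans h8)
    have hv := h9 F.v ((le_max_right _ _).trans h8)
    have hne : F.φ.symm F.u ≠ F.φ.symm F.v := fun h => F.adj.ne (F.φ.symm.injective h)
    have hne' : ((F.φ.symm F.u : Fin n) : ℕ) ≠ (F.φ.symm F.v : Fin n) := fun h => hne (Fin.ext h)
    intro i j
    constructor
    · intro h
      rcases Sym2.eq_iff.1 h with ⟨h10, h11⟩ | ⟨h10, h11⟩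
      · rw [(F.φ.symm_apply_eq).2 h10.symm] at hne hu
        rw [(F.φ.symm_apply_eq).2 h11.symm] at hne hv
        exact ⟨hne, hu, hv⟩
      · rw [(F.φ.symm_apply_eq).2 h11.symm] at hne hu
        rw [(F.φ.symm_apply_eq).2 h10.symm] at hne hv
        exact ⟨hne.symm, hv, hu⟩
    · rintro ⟨h10, h11, h12⟩
      have h10' : (i : ℕ) ≠ j := fun h => h10 (Fin.ext h)
      have h13 : (i = F.φ.symm F.u ∧ j = F.φ.symm F.v) ∨
          (i = F.φ.symm F.v ∧ j = F.φ.symm F.u) := by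
        simp only [Fin.ext_iff]; omega
      rcases h13 with ⟨rfl, rfl⟩ | ⟨rfl, rfl⟩
      · simp
      · simp [Sym2.eq_swap]
  have hstar : ∀ j : Fin n, N ≤ j → F.σ (F.φ j) = F.pt (N - 1) (by omega) := by
    intro j hj
    have h6 := F.σ_mem_K (notMem_K_of_le hj)
    obtain ⟨i, hi, h7⟩ := F.exists_pt h6
    have h8 := htest j
    simp only [hadef, test, not_lt.2 hj, if_false] at h8
    have h9 := le_abs_self (|x (F.φ j)| - |x (F.σ (F.φ j))|)
    have h10 : |x (F.pt (N - 1) (by omega))| ≤ |x (F.σ (F.φ j))| := by linarith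
    rw [← h7, hpt, hpt] at h10
    rcases Nat.lt_or_ge i (N - 1) with h11 | h11
    · exfalso
      rcases Nat.eq_zero_or_pos i with rfl | h12
      · have := hmono (N - 1) (by omega) 1 (by omega) le_rfl
        rw [← h01] at this
        linarith
      · linarith [hmono (N - 1) (by omega) i h11 h12]
    · rw [← h7]
      congr 1
      omega
  have hzero : ∀ i j : Fin n, G.Adj (F.φ i) (F.φ j) → s(F.φ i, F.φ j) ≠ s(F.u, F.v) →
      x (F.φ i) + x (F.φ j) ≠ 0 := by
    intro i j hij hne h
    have hne' : i ≠ j := fun h => hij.ne (congrArg F.φ h)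
    have h6 : a i = a j := by
      rw [← htest, ← htest, eq_neg_of_add_eq_zero_left h, abs_neg]
    rcases hinj i j h6 with h7 | h7 | ⟨hi, hj⟩
    · exact hne' h7
    · exact hne ((huv i j).2 ⟨hne', h7⟩)
    · have key : ∀ k : Fin n, N ≤ k → x (F.φ k) * x (F.pt (N - 1) (by omega)) < 0 := by
        intro k hk
        have hkK := notMem_K_of_le (F := F) hk
        have h8 := hload s(F.φ k, F.σ (F.φ k)) (F.le (F.σ_adj' hkK))
        rw [load_star hα hkK, edgeEnergy_mk, hstar k hk] at h8
        have h9 : 0 < |x (F.φ k)| := by rw [htest]; exact hpos k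
        have h10 : 0 < |x (F.pt (N - 1) (by omega))| := by rw [hpt]; exact hpos _
        nlinarith [mul_pos h9 h10, sq_abs (x (F.φ k)), sq_abs (x (F.pt (N - 1) (by omega)))]
      have h8 := key i hi
      have h9 := key j hj
      rw [eq_neg_of_add_eq_zero_left h] at h8
      linarith
  refine nonempty_iso_uGraph hconn hbip F.three_le hNn F.φ fun i j hij => ?_
  have hne' : (i : ℕ) ≠ j := fun h => hij.ne (congrArg F.φ (Fin.ext h))
  by_cases he : s(F.φ i, F.φ j) = s(F.u, F.v)
  · have h6 := (huv i j).1 he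
    rw [uGraph_adj_iff]
    omega
  have hE' := hload s(F.φ i, F.φ j) hij
  rw [edgeEnergy_mk] at hE'
  have h0 := hzero i j hij he
  have h0' : 0 < (x (F.φ i) + x (F.φ j)) ^ 2 := by positivity
  by_cases hk : F.Kept s(F.φ i, F.φ j)
  · obtain ⟨h6, h7⟩ := load_kept hα hk
    have h8 : F.load α s(F.φ i, F.φ j) = (|x (F.φ i)| - |x (F.φ j)|) ^ 2 :=
      le_antisymm h6 (by rw [hE']; exact sq_abs_sub_abs_le _ _)
    have h9 : |x (F.φ i)| ≠ |x (F.φ j)| := by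
      intro h
      rw [h8, h, sub_self] at hE'
      norm_num at hE'
      exact h0'.ne hE'
    obtain ⟨k, hkN, hpc⟩ := h7 h8 h9
    have hrange : ∀ {s t : ℝ}, Set.Ioc s t = Set.uIoc (|x (F.φ i)|) (|x (F.φ j)|) →
        (a i = s ∧ a j = t) ∨ (a i = t ∧ a j = s) := by
      intro s t hst
      rw [Set.uIoc, htest, htest] at hst
      rw [htest, htest] at h9
      have h10 := Set.Ioc_subset_Ioc_iff (min_lt_max.2 h9) |>.1 hst.symm.subset
      have h11 : s < t := by
        by_contra h
        rw [Set.Ioc_eq_empty h] at hst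
        exact (Set.nonempty_Ioc.2 (min_lt_max.2 h9)).ne_empty hst.symm
      have h12 := Set.Ioc_subset_Ioc_iff h11 |>.1 hst.subset
      have h13 : min (a i) (a j) = s := le_antisymm h12.2 h10.2
      have h14 : max (a i) (a j) = t := le_antisymm h10.1 h12.1
      rcases le_total (a i) (a j) with h | h
      · rw [min_eq_left h] at h13; rw [max_eq_right h] at h14; exact Or.inl ⟨h13, h14⟩
      · rw [min_eq_right h] at h13; rw [max_eq_left h] at h14; exact Or.inr ⟨h14, h13⟩
    have hidx : ∀ (i : Fin n) (k : ℕ) (hk : k < N), a i = a ⟨k, by omega⟩ →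
        (i : ℕ) = k ∨ ((i : ℕ) ≤ 1 ∧ k ≤ 1) := by
      intro i k hk h
      rcases hinj _ _ h with h | h | h
      · rw [h]; simp
      · exact Or.inr h
      · simp only at h; omega
    rw [uGraph_adj_iff]
    by_cases hk0 : (k : ℕ) = 0
    · rw [F.piece_zero hk0, third, hpt, hpt] at hpc
      rcases hrange hpc with ⟨h10, h11⟩ | ⟨h10, h11⟩
      · have h12 := hidx i 0 (by omega) h10
        have h13 := hidx j 2 (by omega) h11
        omega
      · have h12 := hidx i 2 (by omega) h10
        have h13 := hidx j 0 (by omega) h11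
        omega
    · rw [F.piece_pos hk0 hkN, hpt, hpt] at hpc
      rcases hrange hpc with ⟨h10, h11⟩ | ⟨h10, h11⟩
      · have h12 := hidx i _ (by omega) h10
        have h13 := hidx j _ hkN h11
        omega
      · have h12 := hidx i _ hkN h10
        have h13 := hidx j _ (by omega) h11
        omega
  by_cases hs : ∃ w, w ∉ F.K ∧ s(F.φ i, F.φ j) = s(w, F.σ w)
  · have key : ∀ i j : Fin n, F.φ i ∉ F.K → F.φ j = F.σ (F.φ i) →
        N ≤ (i : ℕ) ∧ (j : ℕ) = N - 1 := by
      intro i j hi hj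
      have hiN : N ≤ (i : ℕ) := by
        by_contra h
        exact hi ((F.mem_iff i).2 (not_le.1 h))
      rw [hstar i hiN] at hj
      exact ⟨hiN, congrArg Fin.val (F.φ.injective hj)⟩
    obtain ⟨w, hw, h6⟩ := hs
    rw [uGraph_adj_iff]
    have := i.2
    have := j.2
    rcases Sym2.eq_iff.1 h6 with ⟨rfl, h7⟩ | ⟨h7, rfl⟩
    · have := key i j hw h7
      omega
    · have := key j i hw h7
      omega
  · push Not at hs
    rw [load_other hα he hk hs] at hE'
    linarith

end StarFrame

theorem exists_isDominatingSet_card_eq {V : Type*} [Fintype V] (G : SimpleGraph V) :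
    ∃ S : Finset V, G.IsDominatingSet S ∧ S.card = G.dominationNumber :=
  Nat.sInf_mem (s := {m | ∃ S : Finset V, G.IsDominatingSet S ∧ S.card = m})
    ⟨_, Finset.univ, fun v hv => absurd (Finset.mem_univ v) hv, rfl⟩

theorem exists_starFrame {V : Type*} [Fintype V] {G : SimpleGraph V} (hconn : G.Connected)
    (hbip : ¬ G.IsBipartite) {S : Finset V} (hS : G.IsDominatingSet S) (hS2 : 2 ≤ S.card)
    (hV : 4 ≤ Fintype.card V) (x : V → ℝ) :
    ∃ F : StarFrame G (fun w => |x w|) (Fintype.card V) (min (Fintype.card V) (3 * S.card)),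
      0 ≤ x F.u * x F.v := by
  classical
  set f : V → ℝ := fun w => |x w| with hf
  have hσ' : ∀ w, ∃ s, w ∉ S → s ∈ S ∧ G.Adj w s := by
    intro w
    by_cases hw : w ∈ S
    · exact ⟨w, fun h => absurd hw h⟩
    · obtain ⟨s, hs⟩ := hS w hw
      exact ⟨s, fun _ => hs⟩
  choose σ hσ using hσ'
  obtain ⟨H, κ, u, v, hle, hc, hcol, hadj, hκ, hs, hstar, huv⟩ :
      ∃ (H : SimpleGraph V) (κ : V → Bool) (u v : V), H ≤ G ∧ H.Connected ∧
      (∀ i j, H.Adj i j → κ i ≠ κ j) ∧ G.Adj u v ∧ κ u = κ v ∧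
      decide (0 < x u) = decide (0 < x v) ∧
      (∀ w, w ∉ S → H.Adj w (σ w) ∨ s(w, σ w) = s(u, v)) ∧ (u ∈ S ∨ v ∉ S) := by
    obtain ⟨H, κ, u, v, hle, hc, hcol, hadj, hκ, hs, hstar⟩ :=
      exists_connected_bipartite_le hconn hbip hσ fun w => decide (0 < x w)
    by_cases h : u ∈ S ∨ v ∉ S
    · exact ⟨H, κ, u, v, hle, hc, hcol, hadj, hκ, hs, hstar, h⟩
    · exact ⟨H, κ, v, u, hle, hc, hcol, hadj.symm, hκ.symm, hs.symm,
        fun w hw => by rw [Sym2.eq_swap (a := v)]; exact hstar w hw, by tauto⟩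
  have hx : 0 ≤ x u * x v := by
    rw [decide_eq_decide] at hs
    by_cases h : 0 < x u
    · exact (mul_pos h (hs.1 h)).le
    · exact mul_nonneg_of_nonpos_of_nonpos (not_lt.1 h) (not_lt.1 fun h' => h (hs.2 h'))
  have hσadj : ∀ w, w ∉ S → w ≠ v → H.Adj w (σ w) := by
    intro w hw hwv
    refine (hstar w hw).resolve_right fun h => ?_
    rcases Sym2.eq_iff.1 h with ⟨h1, h2⟩ | ⟨h1, -⟩
    · rcases huv with h3 | h3
      · exact hw (h1 ▸ h3)
      · exact h3 (h2 ▸ (hσ w hw).1)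
    · exact hwv h1
  have hT : ∀ w, w ∉ insert v S ↔ w ∉ S ∧ w ≠ v := fun w => by
    rw [Finset.mem_insert, not_or, and_comm]
  obtain ⟨c, hcS, hcmax⟩ := Finset.exists_max_image S f (Finset.card_pos.1 (by omega))
  obtain ⟨z, hz1, hz2, hz3⟩ : ∃ z,
      (u ∈ S → ∀ y, y ∉ insert v S → H.Adj v y → σ y = u →
        z ∉ insert v S ∧ H.Adj v z ∧ σ z = u) ∧
      (u ∈ S → ∀ y, y ∉ insert v S → H.Adj u y → σ y = v →
        (z ∉ insert v S ∧ σ z = u) ∨ (z ∉ insert v S ∧ H.Adj u z ∧ σ z = v)) ∧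
      (u ∉ S → z = u) := by
    by_cases hu : u ∈ S
    · by_cases h1 : ∃ y, y ∉ insert v S ∧ H.Adj v y ∧ σ y = u
      · obtain ⟨z, hz⟩ := h1
        exact ⟨z, fun _ _ _ _ _ => hz, fun _ _ _ _ _ => Or.inl ⟨hz.1, hz.2.2⟩,
          fun h => absurd hu h⟩
      · by_cases h2 : ∃ y, y ∉ insert v S ∧ H.Adj u y ∧ σ y = v
        · obtain ⟨z, hz⟩ := h2
          exact ⟨z, fun _ y h3 h4 h5 => absurd ⟨y, h3, h4, h5⟩ h1, fun _ _ _ _ _ => Or.inr hz,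
            fun h => absurd hu h⟩
        · exact ⟨u, fun _ y h3 h4 h5 => absurd ⟨y, h3, h4, h5⟩ h1,
            fun _ y h3 h4 h5 => absurd ⟨y, h3, h4, h5⟩ h2, fun _ => rfl⟩
    · exact ⟨u, fun h => absurd h hu, fun h => absurd h hu, fun _ => rfl⟩
  obtain ⟨K, hTK, hK, hlow, hhigh, hzK⟩ := exists_star_selection f (S := S) (T := insert v S)
    (fun w hw => (hσ w ((hT w).1 hw).1).1) hcS (Finset.card_insert_le _ _) z
  simp only [hT] at hlow hhigh hzK hz1 hz2
  have hKS : ∀ y, y ∉ K → y ∉ S ∧ y ≠ v := fun y hy => (hT y).1 fun h => hy (hTK h)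
  obtain ⟨φ, hφ, hmono⟩ := exists_sorted_equiv rfl f K hK
  refine ⟨
    { H := H, κ := κ, u := u, v := v, S := S, K := K, σ := σ, c := c, φ := φ, le := hle
      conn := hc, col := hcol, adj := hadj, col_eq := hκ
      v_mem := hTK (Finset.mem_insert_self _ _)
      S_sub := (Finset.subset_insert _ _).trans hTK, c_mem := hcS, c_max := hcmax
      σ_mem := fun w hw _ => (hσ w hw).1, σ_adj := hσadj, low := hlow, high := hhigh
      special := ?_, mem_iff := hφ, mono := hmono, hN := le_min hV (by omega)
      hNn := min_le_left _ _ }, hx⟩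
  by_cases hu : u ∈ S
  · refine Or.inl ⟨hu, fun y hy h1 h2 => ?_, fun y hy h1 h2 => ?_⟩
    · obtain ⟨h3, h4, h5⟩ := hz1 hu y (hKS y hy) h1 h2
      refine ⟨z, h4, fun h => h3.1 (h ▸ hu), ?_⟩
      rw [← h5]
      exact hzK h3
    · rcases hz2 hu y (hKS y hy) h1 h2 with h3 | ⟨h3, h4, h5⟩
      · exact Or.inl ⟨z, h3⟩
      · refine Or.inr ⟨z, h4, h3.2, ?_⟩
        have h6 := hzK h3
        rw [h5] at h6
        exact h6
  · have hv := huv.resolve_left hu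
    refine Or.inr ⟨hu, hv, ?_⟩
    have h6 := hzK (by rw [hz3 hu]; exact ⟨hu, hadj.ne⟩)
    rwa [hz3 hu] at h6

theorem uPartner_pair_injective {n N : ℕ} (hN : 3 ≤ N) (hNn : N ≤ n) :
    Function.Injective fun j : Fin n => s(j, uPartner hN hNn j) := by
  intro i j h
  rcases Sym2.eq_iff.1 h with ⟨h1, -⟩ | ⟨h1, h2⟩
  · exact h1
  · rw [Fin.ext_iff, uPartner_val] at h1 h2
    apply Fin.ext
    split_ifs at h1 h2 <;> omega

theorem exists_equiv_of_three {V : Type*} [Fintype V] (hV : 3 ≤ Fintype.card V) {a b c : V}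
    (hab : a ≠ b) (hac : a ≠ c) (hbc : b ≠ c) :
    ∃ φ : Fin (Fintype.card V) ≃ V, φ ⟨0, by omega⟩ = a ∧ φ ⟨1, by omega⟩ = b ∧
      φ ⟨2, by omega⟩ = c := by
  classical
  set i₀ : Fin (Fintype.card V) := ⟨0, by omega⟩ with h0
  set i₁ : Fin (Fintype.card V) := ⟨1, by omega⟩ with h1
  set i₂ : Fin (Fintype.card V) := ⟨2, by omega⟩ with h2
  have h01 : i₀ ≠ i₁ := by simp [h0, h1]
  have h02 : i₀ ≠ i₂ := by simp [h0, h2]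
  have h12 : i₁ ≠ i₂ := by simp [h1, h2]
  set e := (Fintype.equivFin V).symm
  set φ₁ := e.trans (Equiv.swap (e i₀) a) with hφ₁
  have ha : φ₁ i₀ = a := by simp [hφ₁]
  set φ₂ := φ₁.trans (Equiv.swap (φ₁ i₁) b) with hφ₂
  have ha2 : φ₂ i₀ = a := by
    rw [hφ₂, Equiv.trans_apply, ha, Equiv.swap_apply_of_ne_of_ne _ hab]
    exact fun h => h01 (φ₁.injective (ha.trans h))
  have hb2 : φ₂ i₁ = b := by simp [hφ₂]
  refine ⟨φ₂.trans (Equiv.swap (φ₂ i₂) c), ?_, ?_, by simp⟩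
  · rw [Equiv.trans_apply, ha2, Equiv.swap_apply_of_ne_of_ne _ hac]
    exact fun h => h02 (φ₂.injective (ha2.trans h))
  · rw [Equiv.trans_apply, hb2, Equiv.swap_apply_of_ne_of_ne _ hbc]
    exact fun h => h12 (φ₂.injective (hb2.trans h))

/-- A connected non-bipartite graph with a dominating vertex contains the extremal graph. -/
theorem exists_equiv_of_isDominatingSet_singleton {V : Type*} [Fintype V] {G : SimpleGraph V}
    (hbip : ¬ G.IsBipartite) {c : V} (hS : G.IsDominatingSet {c}) (hV : 3 ≤ Fintype.card V) :
    ∃ φ : Fin (Fintype.card V) ≃ V, ∀ j, G.Adj (φ j) (φ (uPartner le_rfl hV j)) := by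
  classical
  have hdom : ∀ w, w ≠ c → G.Adj w c := by
    intro w hw
    obtain ⟨s, hs, h⟩ := hS w (by simpa using hw)
    rwa [Finset.mem_singleton.1 hs] at h
  obtain ⟨a, b, hab, hac, hbc⟩ : ∃ a b, G.Adj a b ∧ a ≠ c ∧ b ≠ c := by
    by_contra! h
    refine hbip (isBipartite_of_bool_coloring (fun w => decide (w = c)) fun i j hij h' => ?_)
    rw [decide_eq_decide] at h'
    by_cases hi : i = c
    · exact hij.ne (hi.trans (h'.1 hi).symm)
    · exact hi (h'.2 (h i j hij hi))
  obtain ⟨φ, h0, h1, h2⟩ := exists_equiv_of_three hV hab.ne hac hbc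
  refine ⟨φ, fun j => ?_⟩
  have hpar := uPartner_val le_rfl hV j
  by_cases hj1 : (j : ℕ) = 1
  · have h3 : j = ⟨1, by omega⟩ := Fin.ext hj1
    have h4 : uPartner le_rfl hV j = ⟨0, by omega⟩ := Fin.ext (by rw [hpar]; simp [hj1])
    rw [h4, h3, h0, h1]
    exact hab.symm
  by_cases hj2 : (j : ℕ) = 2
  · have h3 : j = ⟨2, by omega⟩ := Fin.ext hj2
    have h4 : uPartner le_rfl hV j = ⟨1, by omega⟩ := Fin.ext (by rw [hpar]; simp [hj2])
    rw [h4, h3, h1, h2]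
    exact (hdom b hbc).symm
  · have h4 : uPartner le_rfl hV j = ⟨2, by omega⟩ := Fin.ext (by
      rw [hpar]; simp only; split_ifs <;> omega)
    rw [h4, h2]
    refine hdom _ fun h => hj2 ?_
    rw [← h2] at h
    exact congrArg Fin.val (φ.injective h)

theorem uForm_uSign_mul_le {V : Type*} [Fintype V] {G : SimpleGraph V} {n N : ℕ} (hN : 3 ≤ N)
    (hNn : N ≤ n) {φ : Fin n ≃ V} (hφ : ∀ j, G.Adj (φ j) (φ (uPartner hN hNn j))) (x : V → ℝ) :
    uForm hN hNn (fun j => uSign N j * x (φ j)) ≤ G.energy x ∧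
      (uForm hN hNn (fun j => uSign N j * x (φ j)) = G.energy x →
        ∀ i j, G.Adj (φ i) (φ j) → x (φ i) + x (φ j) ≠ 0 → (uGraph n (n - N) 3).Adj i j) := by
  classical
  set ε : Fin n → Sym2 V := fun j => s(φ j, φ (uPartner hN hNn j)) with hε
  have hεinj : Function.Injective ε := fun i j h => by
    refine uPartner_pair_injective hN hNn (Sym2.map.injective φ.injective ?_)
    simpa [hε] using h
  have h1 : uForm hN hNn (fun j => uSign N j * x (φ j)) =
      ∑ e ∈ Finset.univ.image ε, edgeEnergy x e := by
    rw [Finset.sum_image fun i _ j _ h => hεinj h, uForm]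
    refine Finset.sum_congr rfl fun j _ => ?_
    rw [← edgeEnergy_uSign_mul]
    have h2 : ∀ i : Fin n, uSign N i * (uSign N i * x (φ i)) = x (φ i) := fun i => by
      rw [← mul_assoc, ← sq, uSign_sq, one_mul]
    simp only [edgeEnergy_mk, h2, hε]
  have hsub : Finset.univ.image ε ⊆ Finset.univ.filter (fun e : Sym2 V => e ∈ G.edgeSet) := by
    intro e he
    obtain ⟨j, -, rfl⟩ := Finset.mem_image.1 he
    simpa [hε] using hφ j
  rw [h1]
  refine ⟨Finset.sum_le_sum_of_subset_of_nonneg hsub fun e _ _ => edgeEnergy_nonneg x e,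
    fun heq i j hij hne => ?_⟩
  by_contra hU
  refine heq.not_lt (Finset.sum_lt_sum_of_subset hsub (i := s(φ i, φ j)) (by simpa using hij)
    (fun h => ?_) (by rw [edgeEnergy_mk]; positivity) fun e _ _ => edgeEnergy_nonneg x e)
  obtain ⟨k, -, hk⟩ := Finset.mem_image.1 h
  have hadj := uGraph_adj_uPartner hN hNn k
  rcases Sym2.eq_iff.1 hk with ⟨h2, h3⟩ | ⟨h2, h3⟩
  · rw [φ.injective h3, φ.injective h2] at hadj
    exact hU hadj
  · rw [φ.injective h3, φ.injective h2] at hadj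
    exact hU hadj.symm

theorem uGraph_compare_of_isDominatingSet_singleton {V : Type*} [Fintype V] {G : SimpleGraph V}
    (hconn : G.Connected) (hbip : ¬ G.IsBipartite) {c : V} (hS : G.IsDominatingSet {c})
    (hV : 4 ≤ Fintype.card V) :
    (uGraph (Fintype.card V) (Fintype.card V - 3) 3).qMin ≤ G.qMin ∧
      (G.qMin = (uGraph (Fintype.card V) (Fintype.card V - 3) 3).qMin →
        Nonempty (G ≃g uGraph (Fintype.card V) (Fintype.card V - 3) 3)) := by
  have hV3 : 3 ≤ Fintype.card V := by omega
  have := hconn.nonempty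
  obtain ⟨φ, hφ⟩ := exists_equiv_of_isDominatingSet_singleton hbip hS hV3
  obtain ⟨x, hx0, hE⟩ := G.qMin_spec.1
  have hq := qMin_pos hconn hbip
  obtain ⟨h1, h2⟩ := uForm_uSign_mul_le le_rfl hV3 hφ x
  set a : Fin (Fintype.card V) → ℝ := fun j => uSign 3 j * x (φ j) with ha
  have h3 := qMin_uGraph_le le_rfl hV3 a
  have hsum : ∑ j, a j ^ 2 = ∑ w, x w ^ 2 := by
    rw [← φ.sum_comp fun w => x w ^ 2]
    exact Finset.sum_congr rfl fun j _ => by rw [ha, mul_pow, uSign_sq, one_mul]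
  have hpos := StarFrame.sum_sq_pos hx0
  have hle : (uGraph (Fintype.card V) (Fintype.card V - 3) 3).qMin ≤ G.qMin := by
    refine le_of_mul_le_mul_right ?_ hpos
    rw [hsum] at h3
    linarith
  refine ⟨hle, fun heq => ?_⟩
  have hform : uForm le_rfl hV3 a =
      (uGraph (Fintype.card V) (Fintype.card V - 3) 3).qMin * ∑ j, a j ^ 2 := by
    rw [hsum] at h3 ⊢
    rw [← heq] at h3 ⊢
    linarith
  have ha0 : a ≠ 0 := by
    intro h
    rw [← hsum, h] at hpos
    simp at hpos
  have hne := stationary_zero_ne_zero le_rfl hV3 hform hV ha0 (heq ▸ hq) (Or.inr rfl)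
  have h01 := stationary_zero_eq_one le_rfl hV3 hform hV
  have h02 := stationary_two_eq le_rfl hV3 hform
  have hlt := qMin_uGraph_lt_one le_rfl hV3 hV
  have hq' := heq ▸ hq
  have hsame : ∀ j : Fin (Fintype.card V), (j : ℕ) ≠ 2 → 0 < x (φ j) * a ⟨0, by omega⟩ := by
    intro j hj
    have hsq : 0 < a ⟨0, by omega⟩ ^ 2 := by positivity
    have hxa : x (φ j) = a j := by
      simp only [ha, uSign]
      split_ifs with h
      · rw [one_mul]
      · rcases Nat.lt_or_ge j 3 with h4 | h4
        · have h5 : (j : ℕ) = 1 := by omega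
          simp [h5]
        · rw [min_eq_right h4]
          norm_num
    rw [hxa]
    rcases Nat.lt_or_ge j 3 with h4 | h4
    · have h5 : (j : ℕ) = 0 ∨ (j : ℕ) = 1 := by omega
      rcases h5 with h5 | h5
      · rw [show j = ⟨0, by omega⟩ from Fin.ext h5, ← sq]
        exact hsq
      · rw [show j = ⟨1, by omega⟩ from Fin.ext h5, ← h01, ← sq]
        exact hsq
    · have h5 := stationary_leaf le_rfl hV3 hform h4
      simp only [Nat.reduceSub] at h5
      rw [← h01] at h02
      set q := (uGraph (Fintype.card V) (Fintype.card V - 3) 3).qMin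
      set α := a ⟨0, by omega⟩
      have h6 : (1 - q) * (a j * α) = (3 - q) * α ^ 2 := by linear_combination α * h5 - α * h02
      have h7 : 0 < (3 - q) * α ^ 2 := mul_pos (by linarith) hsq
      rw [← h6] at h7
      exact (mul_pos_iff_of_pos_left (by linarith)).1 h7
  refine nonempty_iso_uGraph hconn hbip le_rfl hV3 φ fun i j hij => ?_
  have hij' : (i : ℕ) ≠ j := fun h => hij.ne (congrArg φ (Fin.ext h))
  by_cases h4 : (i : ℕ) = 2 ∨ (j : ℕ) = 2
  · rw [uGraph_adj_iff]
    have := i.2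
    have := j.2
    omega
  · have h5 := hsame i (by tauto)
    have h6 := hsame j (by tauto)
    refine h2 (by rw [hform, hE, hsum, heq]) i j hij fun h => ?_
    have h7 : 0 < (x (φ i) + x (φ j)) * a ⟨0, by omega⟩ := by linarith
    rw [h, zero_mul] at h7
    exact lt_irrefl _ h7

end SimpleGraph

theorem mainTheorem1 {V : Type*} [Fintype V] (G : SimpleGraph V) (n γ : ℕ)
    (hn : Fintype.card V = n) (hn3 : 3 < n)
    (hconn : G.Connected) (hbip : ¬ G.IsBipartite)
    (hγ : G.dominationNumber = γ) (hγn : (γ : ℝ) ≤ ((n : ℝ) + 1) / 3) :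
    (SimpleGraph.uGraphIndices n γ 3).Nonempty ∧
    (SimpleGraph.vGraph n γ 3).qMin ≤ G.qMin ∧
    (G.qMin = (SimpleGraph.vGraph n γ 3).qMin ↔
      Nonempty (G ≃g SimpleGraph.vGraph n γ 3)) := by
  have hγn' : 3 * γ ≤ n + 1 := by
    have : (3 * γ : ℝ) ≤ n + 1 := by linarith
    exact_mod_cast this
  have := hconn.nonempty
  obtain ⟨S, hS, hSc⟩ := G.exists_isDominatingSet_card_eq
  rw [hγ] at hSc
  have hγ1 : 1 ≤ γ := by
    rw [← hSc, Nat.one_le_iff_ne_zero, Ne, Finset.card_eq_zero]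
    rintro rfl
    obtain ⟨s, hs, -⟩ := hS (Classical.arbitrary V) (by simp)
    simp at hs
  have hmain : (SimpleGraph.vGraph n γ 3).qMin ≤ G.qMin ∧
      (G.qMin = (SimpleGraph.vGraph n γ 3).qMin →
        Nonempty (G ≃g SimpleGraph.vGraph n γ 3)) := by
    rw [SimpleGraph.vGraph_three_eq hn3 hγ1 hγn']
    subst hn
    rcases hγ1.eq_or_lt with h1 | h1
    · rw [← h1] at hSc ⊢
      obtain ⟨c, rfl⟩ := Finset.card_eq_one.1 hSc
      rw [show min (Fintype.card V) (3 * 1) = 3 by omega]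
      exact SimpleGraph.uGraph_compare_of_isDominatingSet_singleton hconn hbip hS hn3
    · obtain ⟨x, hx0, hE⟩ := G.qMin_spec.1
      obtain ⟨F, hx⟩ := SimpleGraph.exists_starFrame hconn hbip hS (by omega) hn3 x
      rw [← hSc]
      have hq := SimpleGraph.qMin_pos hconn hbip
      exact ⟨SimpleGraph.StarFrame.qMin_le hx hx0 hE hq,
        SimpleGraph.StarFrame.nonempty_iso hconn hbip hx hx0 hE hq⟩
  exact ⟨⟨_, (SimpleGraph.isLeast_uGraphIndices hn3 hγ1 hγn').1⟩, hmain.1, hmain.2,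
    fun ⟨φ⟩ => SimpleGraph.qMin_eq_of_iso φ⟩
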